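/- Let $N\ge 1$ be an integer, let $\Sigma$ be a domain (a nonempty connected relatively open subset) properly contained in the unit sphere $\mathbb S^{N-1}\subset\mathbb R^N$, and set $$\mathcal C_\Sigma=\{r\sigma : r>0,\ \sigma\in\Sigma\},\qquad \mathcal C_\Sigma^R=\mathcal C_\Sigma\cap B_R=\{r\sigma : 0<r<R,\ \sigma\in\Sigma\},$$ where $B_R$ is the open ball of radius $R$ centred at $0$. Let $$\mu(\mathcal C_\Sigma)=\inf_{u\in C^\infty_c(\mathcal C_\Sigma),\ u\ne 0}\ \frac{\int_{\mathcal C_\Sigma}|\nabla u|^2\,dx}{\int_{\mathcal C_\Sigma}|x|^{-2}|u|^2\,dx}$$ be the best constant in the Hardy inequality on $\mathcal C_\Sigma$. Let $R\in(0,1]$ and $c,\alpha\ge 0$, and let $u\in L^1_{\rm loc}(\mathcal C_\Sigma^R)$ be a nonnegative distributional solution to $$-\Delta u-c\,|x|^{-2}u\ \ge\ \alpha\,|x|^{-2}\bigl|\log|x|\bigr|^{-2}u\quad\text{in }\mathcal D'(\mathcal C_\Sigma^R),$$ that is, for every nonnegative $\varphi\in C^\infty_c(\mathcal C_\Sigma^R)$,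 $$-\int_{\mathcal C_\Sigma^R}u\,\Delta\varphi\,dx-c\int_{\mathcal C_\Sigma^R}|x|^{-2}u\varphi\,dx\ \ge\ \alpha\int_{\mathcal C_\Sigma^R}|x|^{-2}\bigl|\log|x|\bigr|^{-2}u\varphi\,dx .$$ (i) If $c>\mu(\mathcal C_\Sigma)$, then $u=0$ almost everywhere in $\mathcal C_\Sigma^R$. (ii) If $c=\mu(\mathcal C_\Sigma)$ and $\alpha>\frac14$, then $u=0$ almost everywhere in $\mathcal C_\Sigma^R$. -/

import Mathlib

open MeasureTheory
open scoped ContDiff Gradient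

namespace HardyCone

noncomputable section

/-- The cone `{r σ | σ ∈ Sig, r > 0}` over a subset `Sig` of the unit sphere. -/
def cone {N : ℕ} (Sig : Set (Metric.sphere (0 : EuclideanSpace ℝ (Fin N)) 1)) :
    Set (EuclideanSpace ℝ (Fin N)) :=
  {x | ∃ r : ℝ, 0 < r ∧ ∃ σ ∈ Sig, x = r • (σ : EuclideanSpace ℝ (Fin N))}

/-- The cone-like domain: the intersection of the cone with the open ball of radius `R`. -/
def coneBall {N : ℕ} (Sig : Set (Metric.sphere (0 : EuclideanSpace ℝ (Fin N)) 1)) (R : ℝ) :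
    Set (EuclideanSpace ℝ (Fin N)) :=
  cone Sig ∩ Metric.ball 0 R

/-- Real-valued smooth functions with compact support contained in `Ω`. -/
structure IsTestFunction {N : ℕ} (Ω : Set (EuclideanSpace ℝ (Fin N)))
    (φ : EuclideanSpace ℝ (Fin N) → ℝ) : Prop where
  contDiff : ContDiff ℝ ∞ φ
  hasCompactSupport : HasCompactSupport φ
  tsupport_subset : tsupport φ ⊆ Ω

/-- The best constant in the Hardy inequality on the cone over `Sig`: the infimum of
`∫ |∇φ|² / ∫ |x|⁻² |φ|²` over nonzero test functions `φ` on the cone. -/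
def hardyConstant {N : ℕ} (Sig : Set (Metric.sphere (0 : EuclideanSpace ℝ (Fin N)) 1)) : ℝ :=
  sInf {q : ℝ | ∃ φ : EuclideanSpace ℝ (Fin N) → ℝ, IsTestFunction (cone Sig) φ ∧ φ ≠ 0 ∧
    q = (∫ x in cone Sig, ‖∇ φ x‖ ^ 2) / (∫ x in cone Sig, ‖x‖ ^ (-2 : ℤ) * |φ x| ^ 2)}

/-- `u` satisfies `-Δu - c |x|⁻² u ≥ α |x|⁻² |log |x||⁻² u` in the sense of distributions
on `Ω`. -/
def IsDistribSupersolution {N : ℕ} (Ω : Set (EuclideanSpace ℝ (Fin N))) (c α : ℝ)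
    (u : EuclideanSpace ℝ (Fin N) → ℝ) : Prop :=
  ∀ φ : EuclideanSpace ℝ (Fin N) → ℝ, IsTestFunction Ω φ → (∀ x, 0 ≤ φ x) →
    α * (∫ x in Ω, ‖x‖ ^ (-2 : ℤ) * |Real.log ‖x‖| ^ (-2 : ℤ) * u x * φ x) ≤
      -(∫ x in Ω, u x * Laplacian.laplacian φ x) - c * (∫ x in Ω, ‖x‖ ^ (-2 : ℤ) * u x * φ x)

end

end HardyCone

namespace HardyCone

/-! ### Gradient and Laplacian in an orthonormal basis, and Picone's inequality -/

section Calculus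

/-! Suppose `u` is not a.e. zero and write the inequality as `-Δu ≥ V u`, where `V = c|x|⁻² +
α|x|⁻²|log|x||⁻²` is nonnegative and continuous on the truncated cone. By the Allegretto–Piepenbrink
principle (`integral_potential_mul_sq_le`) such a `u` forces `∫ V φ² ≤ ∫ |∇φ|²` for all compactly
supported `C¹` functions `φ`. To see this, mollify `u` to a smooth `w`. The strong maximum principle
makes `w` positive, and uniform continuity of `V` gives `-Δw ≥ (V - η) w` on the support of `φ`.
Apply Picone's inequality to `w`, then let `η → 0`.

The form inequality is tested on `φ(x) = f(-log|x|) ψ(eᵗ x)`, with `ψ` a test function on the whole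
cone and `f` supported in `(-log R, ∞)`. The cone is dilation invariant and `f` confines the support
to `|x| < R`, so every real `t` is allowed. After the dilation `y = eᵗ x` the radial factor is `f(t
- log|y|)`. Integrating over `t` decouples it from `ψ` by translation invariance, and the cross term
vanishes because `∫ f f' = 0`. No spherical coordinates or eigenfunctions on `Σ` are needed. With `D
= ∫ |y|⁻²ψ²`, the result (`integral_gradient_sq_add_of_forall_dilation`) is `c D ∫f² + α D ∫s⁻²f² ≤
(∫|∇ψ|²) ∫f² + D ∫f'²`.

If `c > μ`, choose `ψ` with Rayleigh quotient below `c`, then `f` with `∫f'²/∫f²` small: a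
contradiction. If `c = μ`, letting the quotient of `ψ` tend to `μ` leaves the half-line Hardy
inequality `α ∫s⁻²f² ≤ ∫f'²`, whose sharp constant is `1/4`. -/

theorem contDiff_fderiv_apply {E : Type*} [NormedAddCommGroup E] [NormedSpace ℝ E] {f : E → ℝ} (hf : ContDiff ℝ ∞ f)
    (v : E) : ContDiff ℝ ∞ (fun x => fderiv ℝ f x v) :=
  (hf.fderiv_right (by simp)).clm_apply contDiff_const

variable {E ι : Type*} [NormedAddCommGroup E] [InnerProductSpace ℝ E] [FiniteDimensional ℝ E]
  [Fintype ι]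

theorem norm_gradient_sq_eq_sum (b : OrthonormalBasis ι ℝ E) (f : E → ℝ) (x : E) :
    ‖∇ f x‖ ^ 2 = ∑ i, (fderiv ℝ f x (b i)) ^ 2 := by
  rw [← b.sum_sq_norm_inner_left (∇ f x)]
  simp [inner_gradient_left]

theorem laplacian_eq_sum_fderiv (b : OrthonormalBasis ι ℝ E) {f : E → ℝ} {x : E}
    (hf : ContDiffAt ℝ 2 f x) :
    Laplacian.laplacian f x = ∑ i, fderiv ℝ (fun y => fderiv ℝ f y (b i)) x (b i) := by
  rw [InnerProductSpace.laplacian_eq_iteratedFDeriv_orthonormalBasis f b]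
  refine Finset.sum_congr rfl fun i _ => ?_
  have h : DifferentiableAt ℝ (fderiv ℝ f) x :=
    (hf.fderiv_right (m := 1) (by norm_num)).differentiableAt (by norm_num)
  rw [iteratedFDeriv_two_apply, fderiv_clm_apply h (differentiableAt_const _)]
  simp

theorem continuous_gradient {f : E → ℝ} (hf : ContDiff ℝ 1 f) : Continuous (∇ f) :=
  (InnerProductSpace.toDual ℝ E).symm.continuous.comp (hf.continuous_fderiv (by norm_num))

theorem gradient_eq_zero_of_notMem_tsupport {f : E → ℝ} {x : E} (hx : x ∉ tsupport f) :
    ∇ f x = 0 := by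
  have : fderiv ℝ f x = 0 := by
    by_contra h
    exact hx (support_fderiv_subset ℝ h)
  simp [gradient, this]

theorem laplacian_eq_zero_of_notMem_tsupport {f : E → ℝ} {x : E} (hx : x ∉ tsupport f) :
    Laplacian.laplacian f x = 0 := by
  have h : f =ᶠ[nhds x] fun _ => (0 : ℝ) := notMem_tsupport_iff_eventuallyEq.mp hx
  rw [(InnerProductSpace.laplacian_congr_nhds h).eq_of_nhds]
  simp [InnerProductSpace.laplacian_const]

theorem continuous_laplacian {f : E → ℝ} (hf : ContDiff ℝ ∞ f) :
    Continuous (Laplacian.laplacian f) := by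
  have h2 : ContDiff ℝ 2 f := hf.of_le ENat.LEInfty.out
  have : Laplacian.laplacian f = fun x => ∑ i, fderiv ℝ
      (fun y => fderiv ℝ f y (stdOrthonormalBasis ℝ E i)) x (stdOrthonormalBasis ℝ E i) :=
    funext fun x => laplacian_eq_sum_fderiv _ h2.contDiffAt
  rw [this]
  exact continuous_finsetSum _ fun i _ =>
    (contDiff_fderiv_apply (contDiff_fderiv_apply hf _) _).continuous

theorem laplacian_comp_sub_left {f : E → ℝ} (hf : ContDiff ℝ 2 f) (x y : E) :
    Laplacian.laplacian (fun z => f (x - z)) y = Laplacian.laplacian f (x - y) := by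
  have h2 : ContDiff ℝ 2 (fun z => f (x - z)) := hf.comp (contDiff_const.sub contDiff_id)
  have key : ∀ {g : E → ℝ}, Differentiable ℝ g → ∀ z v : E,
      fderiv ℝ (fun z => g (x - z)) z v = -fderiv ℝ g (x - z) v := by
    intro g hg z v
    have := (hg (x - z)).hasFDerivAt.comp z ((hasFDerivAt_id z).const_sub x)
    rw [show (fun z => g (x - z)) = g ∘ HSub.hSub x from rfl, this.fderiv]
    simp
  have h1 : ∀ v, Differentiable ℝ (fun z => fderiv ℝ f z v) := fun v =>
    ((hf.fderiv_right (m := 1) (by norm_num)).clm_apply contDiff_const).differentiable (by norm_num)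
  rw [laplacian_eq_sum_fderiv (stdOrthonormalBasis ℝ E) h2.contDiffAt,
    laplacian_eq_sum_fderiv (stdOrthonormalBasis ℝ E) hf.contDiffAt]
  refine Finset.sum_congr rfl fun i _ => ?_
  simp_rw [key (hf.differentiable (by norm_num))]
  rw [fderiv_fun_neg, neg_apply,
    key (h1 _), neg_neg]

variable [MeasurableSpace E] [BorelSpace E]

theorem integral_mul_laplacian {h w : E → ℝ} (b : OrthonormalBasis ι ℝ E) (hh : ContDiff ℝ 1 h)
    (hc : HasCompactSupport h) (hw : ContDiff ℝ ∞ w) :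
    ∫ x, h x * Laplacian.laplacian w x =
      -∫ x, ∑ i, fderiv ℝ h x (b i) * fderiv ℝ w x (b i) := by
  have h2 : ContDiff ℝ 2 w := hw.of_le ENat.LEInfty.out
  have hfc : ∀ v, Continuous fun x => fderiv ℝ h x v := fun v =>
    (hh.continuous_fderiv (by norm_num)).clm_apply continuous_const
  have hsupp : ∀ v, HasCompactSupport fun x => fderiv ℝ h x v := fun v =>
    hc.fderiv_apply ℝ v
  have hI1 : ∀ i, Integrable fun x => fderiv ℝ h x (b i) * fderiv ℝ w x (b i) := fun i =>
    ((hfc _).mul (contDiff_fderiv_apply hw _).continuous).integrable_of_hasCompactSupport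
      ((hsupp _).mul_right)
  have hI2 : ∀ i, Integrable fun x => h x * fderiv ℝ (fun y => fderiv ℝ w y (b i)) x (b i) :=
    fun i => (hh.continuous.mul (contDiff_fderiv_apply
      (contDiff_fderiv_apply hw _) _).continuous).integrable_of_hasCompactSupport hc.mul_right
  simp_rw [fun x => laplacian_eq_sum_fderiv b h2.contDiffAt (x := x), Finset.mul_sum]
  rw [integral_finsetSum _ fun i _ => hI2 i, integral_finsetSum _ fun i _ => hI1 i,
    ← Finset.sum_neg_distrib]
  refine Finset.sum_congr rfl fun i _ => ?_
  refine integral_mul_fderiv_eq_neg_fderiv_mul_of_integrable (hI1 i) (hI2 i) ?_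
    (fun x _ => hh.differentiable (by norm_num) x)
    (fun x _ => (contDiff_fderiv_apply hw _).differentiable (by simp) x)
  exact (hh.continuous.mul (contDiff_fderiv_apply hw _).continuous).integrable_of_hasCompactSupport
    hc.mul_right

/-- Picone's inequality in integrated form: if `-Δw ≥ Q w` on the support of `φ` and `w` is
positive there, then `∫ Q φ² ≤ ∫ |∇φ|²`. -/
theorem integral_mul_sq_le_integral_norm_gradient_sq {φ w Q : E → ℝ} (hφ : ContDiff ℝ 1 φ)
    (hc : HasCompactSupport φ) (hw : ContDiff ℝ ∞ w) (hpos : ∀ x ∈ tsupport φ, 0 < w x)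
    (hQ : ∀ x ∈ tsupport φ, Q x * w x ≤ -Laplacian.laplacian w x)
    (hQi : Integrable fun x => Q x * φ x ^ 2) :
    ∫ x, Q x * φ x ^ 2 ≤ ∫ x, ‖∇ φ x‖ ^ 2 := by
  let b := stdOrthonormalBasis ℝ E
  -- Picone's multiplier: `-Δw ≥ Q w` is integrated against `φ²/w`.
  let h : E → ℝ := fun x => φ x ^ 2 / w x
  have hwd : Differentiable ℝ w := hw.differentiable (by simp)
  have hφd : Differentiable ℝ φ := hφ.differentiable (by norm_num)
  have hsub : Function.support h ⊆ tsupport φ := by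
    intro x hx
    refine subset_tsupport _ fun h0 => hx ?_
    simp [h, h0]
  have htsub : tsupport h ⊆ tsupport φ := closure_minimal hsub (isClosed_tsupport _)
  have hh : ContDiff ℝ 1 h := by
    rw [contDiff_iff_contDiffAt]
    intro x
    by_cases hx : x ∈ tsupport φ
    · exact (hφ.contDiffAt.pow 2).div (hw.contDiffAt.of_le (by simp)) (hpos x hx).ne'
    · have : h =ᶠ[nhds x] fun _ => (0 : ℝ) :=
        notMem_tsupport_iff_eventuallyEq.mp fun hx' => hx (htsub hx')
      exact contDiffAt_const.congr_of_eventuallyEq this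
  have hhc : HasCompactSupport h := hc.mono' hsub
  have hint := integral_mul_laplacian b hh hhc hw
  have hgi : Integrable fun x => ‖∇ φ x‖ ^ 2 := by
    refine ((continuous_gradient hφ).norm.pow 2).integrable_of_hasCompactSupport
      (hc.mono' fun x hx => ?_)
    by_contra h0
    exact hx (by simp [gradient_eq_zero_of_notMem_tsupport h0])
  have hsi : Integrable fun x => ∑ i, fderiv ℝ h x (b i) * fderiv ℝ w x (b i) := by
    refine integrable_finsetSum _ fun i _ => ?_
    exact (((hh.continuous_fderiv (by norm_num)).clm_apply continuous_const).mul
      (contDiff_fderiv_apply hw _).continuous).integrable_of_hasCompactSupport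
      ((hhc.fderiv_apply ℝ _).mul_right)
  have hli : Integrable fun x => h x * Laplacian.laplacian w x :=
    (hh.continuous.mul (continuous_laplacian hw)).integrable_of_hasCompactSupport hhc.mul_right
  calc ∫ x, Q x * φ x ^ 2 ≤ ∫ x, -(h x * Laplacian.laplacian w x) := by
        refine integral_mono hQi hli.neg fun x => ?_
        by_cases hx : x ∈ tsupport φ
        · have h1 := hQ x hx
          have h2 := hpos x hx
          have h3 : Q x * φ x ^ 2 = h x * (Q x * w x) := by
            simp only [h]; field_simp
          have h4 : 0 ≤ h x := by positivity
          simp only [h3]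
          nlinarith [mul_le_mul_of_nonneg_left h1 h4]
        · simp [h, image_eq_zero_of_notMem_tsupport hx]
    _ = ∫ x, ∑ i, fderiv ℝ h x (b i) * fderiv ℝ w x (b i) := by
        rw [integral_neg, hint, neg_neg]
    _ ≤ ∫ x, ‖∇ φ x‖ ^ 2 := by
        refine integral_mono hsi hgi fun x => ?_
        simp only [norm_gradient_sq_eq_sum b]
        refine Finset.sum_le_sum fun i _ => ?_
        by_cases hx : x ∈ tsupport φ
        · have h2 := hpos x hx
          have hd : HasFDerivAt h (_ : E →L[ℝ] ℝ) x :=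
            ((hφd x).hasFDerivAt.pow 2).mul ((hasDerivAt_inv h2.ne').comp_hasFDerivAt x
              (hwd x).hasFDerivAt)
          rw [hd.fderiv]
          simp
          -- Completing the square: `∇(φ²/w)·∇w = |∇φ|² - |∇φ - (φ/w)∇w|²`, coordinate by
          -- coordinate.
          have e : (φ x ^ 2 * (-(w x ^ 2)⁻¹ * fderiv ℝ w x (b i)) +
              (w x)⁻¹ * (2 * φ x * fderiv ℝ φ x (b i))) * fderiv ℝ w x (b i) =
              fderiv ℝ φ x (b i) ^ 2 -
                (fderiv ℝ φ x (b i) - φ x * (w x)⁻¹ * fderiv ℝ w x (b i)) ^ 2 := by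
            rw [← inv_pow]; ring
          nlinarith [sq_nonneg (fderiv ℝ φ x (b i) - φ x * (w x)⁻¹ * fderiv ℝ w x (b i))]
        · have : fderiv ℝ h x = 0 := by
            by_contra h0
            exact hx (htsub (support_fderiv_subset ℝ h0))
          simp [this, sq_nonneg]

end Calculus

/-! ### A bump that is subharmonic off a small ball -/

section Barrier

variable {E : Type*} [NormedAddCommGroup E] [InnerProductSpace ℝ E] [FiniteDimensional ℝ E]

theorem laplacian_comp_norm_sub_sq {h h₁ h₂ : ℝ → ℝ} (hh : ContDiff ℝ 2 h)
    (h' : ∀ t, HasDerivAt h (h₁ t) t) (h'' : ∀ t, HasDerivAt h₁ (h₂ t) t) (a k : ℝ) (z x : E) :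
    Laplacian.laplacian (fun y => h ((a - ‖y - z‖ ^ 2) / k)) x =
      4 * ‖x - z‖ ^ 2 / k ^ 2 * h₂ ((a - ‖x - z‖ ^ 2) / k) -
        2 * Module.finrank ℝ E / k * h₁ ((a - ‖x - z‖ ^ 2) / k) := by
  let b := stdOrthonormalBasis ℝ E
  let q : E → ℝ := fun y => (a - ‖y - z‖ ^ 2) / k
  have hq : ∀ y v, fderiv ℝ q y v = -2 * inner ℝ (y - z) v / k ∧ DifferentiableAt ℝ q y := by
    intro y v
    have h1 : HasFDerivAt (fun y => k⁻¹ * (a - ‖y - z‖ ^ 2)) _ y :=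
      ((((hasFDerivAt_id y).sub_const z).norm_sq).const_sub a).const_mul k⁻¹
    have h2 : q = fun y => k⁻¹ * (a - ‖y - z‖ ^ 2) := by
      funext y; simp only [q]; rw [div_eq_inv_mul]
    rw [h2]
    refine ⟨?_, h1.differentiableAt⟩
    erw [h1.fderiv]
    simp [inner_sub_left]
    ring
  have hqc : ContDiff ℝ 2 q :=
    (contDiff_const.sub ((contDiff_id.sub contDiff_const).norm_sq ℝ)).div_const k
  have hf : ContDiff ℝ 2 (fun y => h (q y)) := hh.comp hqc
  have h1 : ∀ y v, fderiv ℝ (fun y => h (q y)) y v = h₁ (q y) * (-2 * inner ℝ (y - z) v / k) := by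
    intro y v
    rw [← (hq y v).1]
    have := (h' (q y)).comp_hasFDerivAt y (hq y v).2.hasFDerivAt
    rw [show (fun y => h (q y)) = h ∘ q from rfl, this.fderiv]
    simp
  have h2 : ∀ y v, ‖v‖ = 1 → fderiv ℝ (fun y => h₁ (q y) * (-2 * inner ℝ (y - z) v / k)) y v =
      4 * (inner ℝ (y - z) v) ^ 2 / k ^ 2 * h₂ (q y) - 2 / k * h₁ (q y) := by
    intro y v hv
    have e1 := (h'' (q y)).comp_hasFDerivAt y (hq y v).2.hasFDerivAt
    have e2 : HasFDerivAt (fun y => (-2 / k) * inner ℝ v (y - z)) _ y :=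
      (((innerSL ℝ v).hasFDerivAt (x := y - z)).comp y
        ((hasFDerivAt_id y).sub_const z)).const_mul (-2 / k)
    have e3 := e1.mul e2
    have e4 : (fun y => h₁ (q y) * (-2 * inner ℝ (y - z) v / k)) =
        (h₁ ∘ q) * fun y => (-2 / k) * inner ℝ v (y - z) := by
      funext y
      simp only [Pi.mul_apply, Function.comp_apply]
      rw [real_inner_comm]; ring
    rw [e4, e3.fderiv]
    simp [(hq y v).1, hv]
    rw [real_inner_comm]
    ring
  rw [show (fun y => h ((a - ‖y - z‖ ^ 2) / k)) = fun y => h (q y) from rfl,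
    laplacian_eq_sum_fderiv b hf.contDiffAt]
  simp_rw [h1]
  rw [Finset.sum_congr rfl fun i _ => h2 x (b i) (b.orthonormal.1 i)]
  rw [Finset.sum_sub_distrib, show (a - ‖x - z‖ ^ 2) / k = q x from rfl,
    ← b.sum_sq_norm_inner_left (x - z)]
  simp only [Real.norm_eq_abs, sq_abs, Finset.sum_const, Finset.card_univ, Fintype.card_fin,
    nsmul_eq_mul]
  rw [← Finset.sum_mul, ← Finset.sum_div, Finset.mul_sum]
  ring

/-- A smooth bump supported in a ball which is strictly subharmonic on an annulus. -/
theorem exists_barrier (z : E) {s r : ℝ} (hs : 0 < s) (hsr : s < r) :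
    ∃ φ : E → ℝ, ContDiff ℝ ∞ φ ∧ tsupport φ ⊆ Metric.closedBall z r ∧ (∀ x, 0 ≤ φ x) ∧
      (∀ x, s < ‖x - z‖ → 0 ≤ Laplacian.laplacian φ x) ∧
      ∀ x, s < ‖x - z‖ → ‖x - z‖ < r → 0 < Laplacian.laplacian φ x := by
  set n : ℝ := (Module.finrank ℝ E : ℝ) with hn
  have hn0 : 0 ≤ n := Nat.cast_nonneg _
  have hr : 0 < r := hs.trans hsr
  -- With `q` the argument of the glue function, the first summand gives `q ≤ 1/4` and the second `n
  -- q² k < s²`. Together they make the second-order term of the Laplacian dominate once `‖x - z‖ >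
  -- s`.
  let k : ℝ := 4 * r ^ 2 + n * r ^ 4 / s ^ 2
  have hk : 0 < k := by positivity
  let φ : E → ℝ := fun y => expNegInvGlue ((r ^ 2 - ‖y - z‖ ^ 2) / k)
  have h1 : ∀ t : ℝ, HasDerivAt expNegInvGlue (t⁻¹ ^ 2 * expNegInvGlue t) t := fun t => by
    simpa using expNegInvGlue.hasDerivAt_polynomial_eval_inv_mul 1 t
  have h2 : ∀ t : ℝ, HasDerivAt (fun t => t⁻¹ ^ 2 * expNegInvGlue t)
      (t⁻¹ ^ 2 * (t⁻¹ ^ 2 - 2 * t⁻¹) * expNegInvGlue t) t := fun t => by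
    have h := expNegInvGlue.hasDerivAt_polynomial_eval_inv_mul (Polynomial.X ^ 2) t
    simp only [Polynomial.eval_mul, Polynomial.eval_sub, Polynomial.eval_pow, Polynomial.eval_X,
      Polynomial.derivative_X_sq, Polynomial.eval_C] at h
    exact h
  have hL := fun x => laplacian_comp_norm_sub_sq (expNegInvGlue.contDiff (n := 2)) h1 h2 (r ^ 2) k z x
  have hzero : ∀ x, r ≤ ‖x - z‖ → expNegInvGlue ((r ^ 2 - ‖x - z‖ ^ 2) / k) = 0 := by
    intro x hx
    apply expNegInvGlue.zero_of_nonpos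
    exact div_nonpos_of_nonpos_of_nonneg (by nlinarith) hk.le
  have hLpos : ∀ x, s < ‖x - z‖ → ‖x - z‖ < r → 0 < Laplacian.laplacian φ x := by
    intro x hx1 hx2
    rw [hL x]
    set t := ‖x - z‖ with ht
    set q := (r ^ 2 - t ^ 2) / k with hq
    have hq0 : 0 < q := div_pos (by nlinarith) hk
    have hqk : q * k = r ^ 2 - t ^ 2 := by rw [hq]; field_simp
    have hh := expNegInvGlue.pos_of_pos hq0
    have hs2 : s ^ 2 < t ^ 2 := by nlinarith
    have hq4 : q ≤ 1 / 4 := by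
      rw [hq, div_le_iff₀ hk]
      have : 0 ≤ n * r ^ 4 / s ^ 2 := by positivity
      simp only [k]
      nlinarith
    have hks : n * r ^ 4 < k * s ^ 2 := by
      simp only [k]
      rw [add_mul, div_mul_cancel₀ _ (by positivity)]
      have : 0 < 4 * r ^ 2 * s ^ 2 := by positivity
      linarith
    have hqr : (q * k) ^ 2 ≤ r ^ 4 := by
      rw [hqk]
      have : 0 < r ^ 2 - t ^ 2 := by nlinarith
      nlinarith
    have key : 0 < 2 * t ^ 2 * (1 - 2 * q) - n * q ^ 2 * k := by
      have h3 : n * q ^ 2 * k < s ^ 2 := by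
        have : n * (q * k) ^ 2 ≤ n * r ^ 4 := mul_le_mul_of_nonneg_left hqr hn0
        have : (n * q ^ 2 * k) * k < s ^ 2 * k := by nlinarith
        exact lt_of_mul_lt_mul_right this hk.le
      nlinarith
    have e : 4 * t ^ 2 / k ^ 2 * (q⁻¹ ^ 2 * (q⁻¹ ^ 2 - 2 * q⁻¹) * expNegInvGlue q) -
        2 * n / k * (q⁻¹ ^ 2 * expNegInvGlue q) =
        2 / k ^ 2 * q⁻¹ ^ 4 * expNegInvGlue q * (2 * t ^ 2 * (1 - 2 * q) - n * q ^ 2 * k) := by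
      field_simp
      ring
    rw [e]
    positivity
  refine ⟨φ, ?_, ?_, fun x => expNegInvGlue.nonneg _, ?_, hLpos⟩
  · exact expNegInvGlue.contDiff.comp
      ((contDiff_const.sub ((contDiff_id.sub contDiff_const).norm_sq ℝ)).div_const k)
  · refine closure_minimal (fun x hx => ?_) Metric.isClosed_closedBall
    rw [Metric.mem_closedBall, dist_eq_norm]
    by_contra h
    exact hx (hzero x (not_le.mp h).le)
  · intro x hx
    rcases lt_or_ge ‖x - z‖ r with h | h
    · exact (hLpos x hx h).le
    · rw [hL x, hzero x h]; simp

end Barrier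

/-! ### Strong maximum principle for distributional supersolutions -/

section Supersolution

variable {N : ℕ} {Ω : Set (EuclideanSpace ℝ (Fin N))} {u : EuclideanSpace ℝ (Fin N) → ℝ}

theorem integrableOn_mul_of_tsupport_subset (hu : LocallyIntegrableOn u Ω volume)
    {g : EuclideanSpace ℝ (Fin N) → ℝ} (hg : Continuous g) (hc : HasCompactSupport g)
    (hs : tsupport g ⊆ Ω) : IntegrableOn (fun x => u x * g x) Ω := by
  have h1 : IntegrableOn (fun x => g x * u x) (tsupport g) :=
    (hu.integrableOn_compact_subset hs hc).continuousOn_mul hg.continuousOn hc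
  have h2 : Integrable (fun x => g x * u x) := by
    refine (integrableOn_iff_integrable_of_support_subset fun x hx => ?_).mp h1
    exact subset_tsupport _ fun h0 => hx (by simp [h0])
  simpa [mul_comm] using h2.integrableOn (s := Ω)

theorem tsupport_laplacian_subset {E : Type*} [NormedAddCommGroup E] [InnerProductSpace ℝ E]
    [FiniteDimensional ℝ E] (φ : E → ℝ) : tsupport (Laplacian.laplacian φ) ⊆ tsupport φ :=
  closure_minimal (fun _ hx => by_contra fun h => hx (laplacian_eq_zero_of_notMem_tsupport h))
    (isClosed_tsupport _)

theorem IsTestFunction.integrableOn_mul_laplacian (hu : LocallyIntegrableOn u Ω volume)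
    {φ : EuclideanSpace ℝ (Fin N) → ℝ} (hφ : IsTestFunction Ω φ) :
    IntegrableOn (fun x => u x * Laplacian.laplacian φ x) Ω :=
  integrableOn_mul_of_tsupport_subset hu (continuous_laplacian hφ.contDiff)
    (hφ.hasCompactSupport.of_isClosed_subset (isClosed_tsupport _) (tsupport_laplacian_subset φ))
    ((tsupport_laplacian_subset φ).trans hφ.tsupport_subset)

/-- Test with a barrier `φ` whose Laplacian can be negative only where `u` already vanishes. Then `u
Δφ ≥ 0` has nonpositive integral, so it is zero a.e., and `Δφ > 0` on the annulus kills `u` there.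
-/
theorem ae_eq_zero_ball_of_superharmonic (hΩ : IsOpen Ω) (hu : LocallyIntegrableOn u Ω volume)
    (hu0 : ∀ᵐ x ∂volume.restrict Ω, 0 ≤ u x)
    (hsup : ∀ φ, IsTestFunction Ω φ → (∀ x, 0 ≤ φ x) →
      ∫ x in Ω, u x * Laplacian.laplacian φ x ≤ 0)
    {z : EuclideanSpace ℝ (Fin N)} {s r : ℝ} (hs : 0 < s) (hr : Metric.closedBall z r ⊆ Ω)
    (hz : ∀ᵐ x ∂volume.restrict (Metric.ball z s), u x = 0) :
    ∀ᵐ x ∂volume.restrict (Metric.ball z r), u x = 0 := by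
  rcases le_or_gt r (s / 2) with hrs | hrs
  · exact ae_restrict_of_ae_restrict_of_subset (Metric.ball_subset_ball (by linarith)) hz
  -- Inner radius `s / 2`, so that the strict positivity of `Δφ` also covers the sphere of radius
  -- `s`.
  obtain ⟨φ, hφ, hφs, hφ0, hφ1, hφ2⟩ := exists_barrier z (half_pos hs) hrs
  have ht : IsTestFunction Ω φ :=
    ⟨hφ, (isCompact_closedBall z r).of_isClosed_subset (isClosed_tsupport _) hφs, hφs.trans hr⟩
  rw [ae_restrict_iff' measurableSet_ball] at hz
  have h0 : 0 ≤ᵐ[volume.restrict Ω] fun x => u x * Laplacian.laplacian φ x := by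
    filter_upwards [hu0, ae_restrict_of_ae hz] with x hx1 hx2
    by_cases hx : x ∈ Metric.ball z s
    · simp [hx2 hx]
    · refine mul_nonneg hx1 (hφ1 x ?_)
      rw [Metric.mem_ball, dist_eq_norm] at hx
      linarith
  have h1 : ∀ᵐ x ∂volume.restrict Ω, u x * Laplacian.laplacian φ x = 0 :=
    (integral_eq_zero_iff_of_nonneg_ae h0 (ht.integrableOn_mul_laplacian hu)).mp
      (le_antisymm (hsup φ ht hφ0) (integral_nonneg_of_ae h0))
  rw [ae_restrict_iff' hΩ.measurableSet] at h1
  rw [ae_restrict_iff' measurableSet_ball]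
  filter_upwards [hz, h1] with x hx1 hx2 hxr
  by_cases hx : x ∈ Metric.ball z s
  · exact hx1 hx
  · have := hφ2 x (by rw [Metric.mem_ball, dist_eq_norm] at hx; linarith)
      (by rwa [Metric.mem_ball, dist_eq_norm] at hxr)
    exact (mul_eq_zero.mp (hx2 (hr (Metric.ball_subset_closedBall hxr)))).resolve_right this.ne'

/-- Strong maximum principle for locally integrable superharmonic functions. -/
theorem ae_eq_zero_of_superharmonic (hΩ : IsOpen Ω) (hΩc : IsPreconnected Ω)
    (hu : LocallyIntegrableOn u Ω volume) (hu0 : ∀ᵐ x ∂volume.restrict Ω, 0 ≤ u x)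
    (hsup : ∀ φ, IsTestFunction Ω φ → (∀ x, 0 ≤ φ x) →
      ∫ x in Ω, u x * Laplacian.laplacian φ x ≤ 0)
    {z : EuclideanSpace ℝ (Fin N)} {s : ℝ} (hs : 0 < s) (hzΩ : z ∈ Ω)
    (hz : ∀ᵐ x ∂volume.restrict (Metric.ball z s), u x = 0) :
    ∀ᵐ x ∂volume.restrict Ω, u x = 0 := by
  let Z : Set (EuclideanSpace ℝ (Fin N)) :=
    {x | ∃ s > 0, ∀ᵐ y ∂volume.restrict (Metric.ball x s), u y = 0}
  have hZo : IsOpen Z := by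
    rw [Metric.isOpen_iff]
    rintro x ⟨s, hs, hx⟩
    refine ⟨s / 2, half_pos hs, fun y hy => ⟨s / 2, half_pos hs, ?_⟩⟩
    refine ae_restrict_of_ae_restrict_of_subset (Metric.ball_subset_ball' ?_) hx
    rw [Metric.mem_ball] at hy
    linarith
  -- Connectedness: `Z` is open, and it is closed relative to `Ω` because vanishing spreads from any
  -- small ball to a ball of controlled radius `δ / 2`.
  have hsub : Ω ⊆ Z := by
    refine hΩc.subset_of_closure_inter_subset hZo ⟨z, hzΩ, s, hs, hz⟩ ?_
    rintro x ⟨hx, hxΩ⟩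
    obtain ⟨δ, hδ, hball⟩ := Metric.isOpen_iff.mp hΩ x hxΩ
    obtain ⟨y, ⟨t, ht, hy⟩, hxy⟩ := Metric.mem_closure_iff.mp hx (δ / 4) (by positivity)
    have := ae_eq_zero_ball_of_superharmonic hΩ hu hu0 hsup ht (r := δ / 2)
      (fun w hw => hball (by
        rw [Metric.mem_closedBall] at hw
        rw [Metric.mem_ball]
        have := dist_triangle w y x
        rw [dist_comm y x] at this
        linarith)) hy
    refine ⟨δ / 4, by positivity, ae_restrict_of_ae_restrict_of_subset
      (Metric.ball_subset_ball' ?_) this⟩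
    linarith
  rw [ae_restrict_iff' hΩ.measurableSet, ae_iff]
  refine measure_null_of_locally_null _ fun x hx => ?_
  simp only [Set.mem_ofPred_eq, Classical.not_imp] at hx
  obtain ⟨s, hs, hx'⟩ := hsub hx.1
  rw [ae_restrict_iff' measurableSet_ball, ae_iff] at hx'
  refine ⟨Metric.ball x s ∩ {a | ¬(a ∈ Ω → u a = 0)},
    Filter.inter_mem (mem_nhdsWithin_of_mem_nhds (Metric.ball_mem_nhds x hs)) self_mem_nhdsWithin,
    measure_mono_null (fun y hy => ?_) hx'⟩
  simp only [Set.mem_inter_iff, Set.mem_ofPred_eq, Classical.not_imp] at hy ⊢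
  exact ⟨hy.1, hy.2.2⟩

end Supersolution

/-! ### Differentiating convolutions with a smooth kernel -/

section Mollification

variable {E : Type*} [NormedAddCommGroup E] [InnerProductSpace ℝ E] [FiniteDimensional ℝ E]
  [MeasurableSpace E] [BorelSpace E]

theorem fderiv_integral_mul_sub {f ρ : E → ℝ} (hf : LocallyIntegrable f) (hρ : ContDiff ℝ 1 ρ)
    (hc : HasCompactSupport ρ) (x v : E) :
    fderiv ℝ (fun x => ∫ t, f t * ρ (x - t)) x v = ∫ t, f t * fderiv ℝ ρ (x - t) v := by
  have h := hc.hasFDerivAt_convolution_right (ContinuousLinearMap.mul ℝ ℝ) hf hρ x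
  have e : (fun x => ∫ t, f t * ρ (x - t)) =
      convolution f ρ (ContinuousLinearMap.mul ℝ ℝ) volume := by
    funext x; simp [convolution_def]
  rw [e, h.fderiv, convolution_precompR_apply _ hf (hc.fderiv ℝ)
    (hρ.continuous_fderiv (by norm_num))]
  simp [convolution_def]

theorem contDiff_integral_mul_sub {f ρ : E → ℝ} (hf : LocallyIntegrable f) (hρ : ContDiff ℝ ∞ ρ)
    (hc : HasCompactSupport ρ) : ContDiff ℝ ∞ (fun x => ∫ t, f t * ρ (x - t)) := by
  have e : (fun x => ∫ t, f t * ρ (x - t)) =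
      convolution f ρ (ContinuousLinearMap.mul ℝ ℝ) volume := by
    funext x; simp [convolution_def]
  rw [e]
  exact hc.contDiff_convolution_right _ hf hρ

theorem laplacian_integral_mul_sub {f ρ : E → ℝ} (hf : LocallyIntegrable f)
    (hρ : ContDiff ℝ ∞ ρ) (hc : HasCompactSupport ρ) (x : E) :
    Laplacian.laplacian (fun x => ∫ t, f t * ρ (x - t)) x =
      ∫ t, f t * Laplacian.laplacian ρ (x - t) := by
  let b := stdOrthonormalBasis ℝ E
  have h1 : ContDiff ℝ 1 ρ := hρ.of_le ENat.LEInfty.out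
  have h2 : ContDiff ℝ 2 ρ := hρ.of_le ENat.LEInfty.out
  have hd : ∀ v, ContDiff ℝ ∞ fun x => fderiv ℝ ρ x v := contDiff_fderiv_apply hρ
  rw [laplacian_eq_sum_fderiv b
    ((contDiff_integral_mul_sub hf hρ hc).of_le ENat.LEInfty.out).contDiffAt]
  simp_rw [fderiv_integral_mul_sub hf h1 hc,
    fun v => fderiv_integral_mul_sub hf ((hd v).of_le ENat.LEInfty.out) (hc.fderiv_apply ℝ v),
    fun t => laplacian_eq_sum_fderiv b (h2.contDiffAt (x := x - t)), Finset.mul_sum]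
  refine (integral_finsetSum _ fun i _ => ?_).symm
  have := (hc.fderiv_apply ℝ (b i)).fderiv_apply ℝ (b i)
  have := this.convolutionExists_right (ContinuousLinearMap.mul ℝ ℝ) hf
    (contDiff_fderiv_apply (hd (b i)) (b i)).continuous x
  simpa [ConvolutionExistsAt] using this

end Mollification

/-! ### From a nonnegative supersolution to a form inequality -/

section AllegrettoPiepenbrink

variable {N : ℕ} {Ω : Set (EuclideanSpace ℝ (Fin N))} {u V : EuclideanSpace ℝ (Fin N) → ℝ}

theorem integrableOn_mul_mul_of_tsupport_subset (hΩ : IsOpen Ω) (hu : LocallyIntegrableOn u Ω volume)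
    (hV : ContinuousOn V Ω) {g : EuclideanSpace ℝ (Fin N) → ℝ} (hg : Continuous g)
    (hc : HasCompactSupport g) (hs : tsupport g ⊆ Ω) :
    IntegrableOn (fun x => V x * u x * g x) Ω := by
  have h1 : tsupport (fun x => V x * g x) ⊆ tsupport g := tsupport_mul_subset_right
  have h2 : Continuous fun x => V x * g x :=
    (hV.mul hg.continuousOn).continuous_of_tsupport_subset hΩ (h1.trans hs)
  refine (integrableOn_mul_of_tsupport_subset hu h2 (hc.mul_left) (h1.trans hs)).congr_fun ?_
    hΩ.measurableSet
  intro x _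
  simp only
  ring

theorem IsTestFunction.comp_sub_left {ρ : EuclideanSpace ℝ (Fin N) → ℝ} (hρ : ContDiff ℝ ∞ ρ)
    {ε : ℝ} (hε : tsupport ρ ⊆ Metric.closedBall 0 ε) {x : EuclideanSpace ℝ (Fin N)}
    (hx : Metric.closedBall x ε ⊆ Ω) : IsTestFunction Ω (fun t => ρ (x - t)) := by
  have h : tsupport (fun t => ρ (x - t)) ⊆ Metric.closedBall x ε := by
    refine closure_minimal (fun t ht => ?_) Metric.isClosed_closedBall
    have := hε (subset_tsupport _ (show x - t ∈ Function.support ρ from ht))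
    rwa [mem_closedBall_zero_iff, ← dist_eq_norm, dist_comm] at this
  exact ⟨hρ.comp (contDiff_const.sub contDiff_id),
    (isCompact_closedBall x ε).of_isClosed_subset (isClosed_tsupport _) h, h.trans hx⟩

/-- Mollifying a nontrivial nonnegative distributional solution of `-Δu ≥ V u` gives a smooth
positive `w` with `-Δw ≥ (V - η) w` near a compact set. -/
theorem exists_contDiff_supersolution (hΩ : IsOpen Ω) (hΩc : IsPreconnected Ω)
    (hu : LocallyIntegrableOn u Ω volume) (hu0 : ∀ᵐ x ∂volume.restrict Ω, 0 ≤ u x)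
    (hV : ContinuousOn V Ω) (hV0 : ∀ x ∈ Ω, 0 ≤ V x)
    (hsup : ∀ φ, IsTestFunction Ω φ → (∀ x, 0 ≤ φ x) →
      ∫ x in Ω, V x * u x * φ x ≤ -∫ x in Ω, u x * Laplacian.laplacian φ x)
    (hne : ¬ ∀ᵐ x ∂volume.restrict Ω, u x = 0) {K : Set (EuclideanSpace ℝ (Fin N))}
    (hK : IsCompact K) (hKΩ : K ⊆ Ω) {η : ℝ} (hη : 0 < η) :
    ∃ w : EuclideanSpace ℝ (Fin N) → ℝ, ContDiff ℝ ∞ w ∧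
      ∀ x ∈ K, 0 < w x ∧ (V x - η) * w x ≤ -Laplacian.laplacian w x := by
  obtain ⟨ε₀, hε₀, hthick⟩ := hK.exists_cthickening_subset_open hΩ hKΩ
  let K' := Metric.cthickening ε₀ K
  have hK' : IsCompact K' := hK.cthickening
  have hunif := hK'.uniformContinuousOn_of_continuous (hV.mono hthick)
  obtain ⟨δ, hδ, hVδ⟩ := Metric.uniformContinuousOn_iff.mp hunif η hη
  obtain ⟨ε, hε, hεε₀, hεδ⟩ : ∃ ε > 0, ε ≤ ε₀ ∧ ε < δ :=
    ⟨min ε₀ (δ / 2), lt_min hε₀ (half_pos hδ), min_le_left _ _,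
      (min_le_right _ _).trans_lt (half_lt_self hδ)⟩
  let B : ContDiffBump (0 : EuclideanSpace ℝ (Fin N)) := ⟨ε / 2, ε, half_pos hε, half_lt_self hε⟩
  have hBs : tsupport (B : EuclideanSpace ℝ (Fin N) → ℝ) ⊆ Metric.closedBall 0 ε :=
    B.tsupport_eq.subset
  have hBd : ContDiff ℝ ∞ (B : EuclideanSpace ℝ (Fin N) → ℝ) := B.contDiff
  -- Cutting `u` off to `K'` makes the convolution globally defined and smooth. Over points of `K`
  -- the kernel sees only `K'`, so nothing changes there.
  have hf : Integrable (K'.indicator u) :=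
    (integrable_indicator_iff hK'.measurableSet).mpr (hu.integrableOn_compact_subset hthick hK')
  have hball : ∀ x ∈ K, Metric.closedBall x ε ⊆ K' := fun x hx =>
    (Metric.closedBall_subset_cthickening hx ε).trans (Metric.cthickening_mono hεε₀ K)
  have htest : ∀ x ∈ K, IsTestFunction Ω (fun t => B (x - t)) := fun x hx =>
    IsTestFunction.comp_sub_left hBd hBs ((hball x hx).trans hthick)
  have hind : ∀ g : EuclideanSpace ℝ (Fin N) → ℝ, ∀ x ∈ K, (∀ t, t ∉ Metric.closedBall x ε → g t = 0) →
      ∫ t, K'.indicator u t * g t = ∫ t in Ω, u t * g t := by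
    intro g x hx hg
    rw [← integral_indicator hΩ.measurableSet]
    congr 1
    funext t
    by_cases ht : t ∈ K'
    · simp [ht, hthick ht]
    · have := hg t fun h => ht (hball x hx h)
      by_cases ht' : t ∈ Ω <;> simp [ht, ht', this]
  refine ⟨fun x => ∫ t, K'.indicator u t * B (x - t),
    contDiff_integral_mul_sub hf.locallyIntegrable hBd B.hasCompactSupport, fun x hx => ?_⟩
  have hB0 : ∀ t, t ∉ Metric.closedBall x ε → B (x - t) = 0 := by
    intro t ht
    refine B.zero_of_le_dist ?_
    rw [Metric.mem_closedBall, dist_eq_norm, norm_sub_rev, ← dist_zero_right] at ht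
    exact (not_le.mp ht).le
  have hwx := hind _ x hx hB0
  have hBi : IntegrableOn (fun t => u t * B (x - t)) Ω :=
    integrableOn_mul_of_tsupport_subset hu (htest x hx).contDiff.continuous
      (htest x hx).hasCompactSupport (htest x hx).tsupport_subset
  have hnn : 0 ≤ᵐ[volume.restrict Ω] fun t => u t * B (x - t) := by
    filter_upwards [hu0] with t ht using mul_nonneg ht B.nonneg
  have hsuper : ∀ φ, IsTestFunction Ω φ → (∀ x, 0 ≤ φ x) →
      ∫ x in Ω, u x * Laplacian.laplacian φ x ≤ 0 := by
    intro φ hφ hφ0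
    have h1 := hsup φ hφ hφ0
    have h2 : 0 ≤ ∫ x in Ω, V x * u x * φ x := by
      refine integral_nonneg_of_ae ?_
      filter_upwards [hu0, ae_restrict_mem hΩ.measurableSet] with t ht htΩ
      exact mul_nonneg (mul_nonneg (hV0 t htΩ) ht) (hφ0 t)
    linarith
  constructor
  · simp only [hwx]
    -- If `w x = 0`, then `u` vanishes a.e. on the ball of radius `ε` about `x`, hence on `Ω` by the
    -- maximum principle.
    refine lt_of_le_of_ne (integral_nonneg_of_ae hnn) fun h0 => hne ?_
    have hz := (integral_eq_zero_iff_of_nonneg_ae hnn hBi).mp h0.symm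
    refine ae_eq_zero_of_superharmonic hΩ hΩc hu hu0 hsuper hε (hKΩ hx) ?_
    have hz' := ae_restrict_of_ae_restrict_of_subset
      ((Metric.ball_subset_closedBall.trans (hball x hx)).trans hthick) hz
    filter_upwards [hz', ae_restrict_mem measurableSet_ball] with t ht htb
    refine (mul_eq_zero.mp ht).resolve_right (B.pos_of_mem_ball ?_).ne'
    rwa [mem_ball_zero_iff, ← dist_eq_norm, dist_comm]
  · rw [laplacian_integral_mul_sub hf.locallyIntegrable hBd B.hasCompactSupport]
    simp only [hwx]
    have hΔ : ∀ t, Laplacian.laplacian (B : EuclideanSpace ℝ (Fin N) → ℝ) (x - t) =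
        Laplacian.laplacian (fun t => B (x - t)) t :=
      fun t => (laplacian_comp_sub_left (hBd.of_le ENat.LEInfty.out) x t).symm
    rw [hind _ x hx fun t ht => by
      refine laplacian_eq_zero_of_notMem_tsupport fun h => ht ?_
      have := hBs h
      rwa [mem_closedBall_zero_iff, ← dist_eq_norm, dist_comm] at this]
    simp_rw [hΔ]
    -- The supersolution inequality is tested on the kernel centred at `x`; replacing `V t` by `V x
    -- - η` under the integral is allowed since `ε < δ`.
    refine le_trans ?_ (hsup _ (htest x hx) fun t => B.nonneg)
    rw [← integral_const_mul]
    refine integral_mono_ae (hBi.const_mul _) (integrableOn_mul_mul_of_tsupport_subset hΩ hu hV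
      (htest x hx).contDiff.continuous (htest x hx).hasCompactSupport
      (htest x hx).tsupport_subset) ?_
    filter_upwards [hnn] with t ht
    by_cases htb : t ∈ Metric.closedBall x ε
    · have h1 := hVδ x (Metric.self_subset_cthickening _ hx) t (hball x hx htb)
        (by rw [dist_comm]; exact (Metric.mem_closedBall.mp htb).trans_lt hεδ)
      rw [Real.dist_eq] at h1
      have h2 : V x - η ≤ V t := by linarith [(abs_lt.mp h1).2]
      calc (V x - η) * (u t * B (x - t)) ≤ V t * (u t * B (x - t)) :=
            mul_le_mul_of_nonneg_right h2 ht
        _ = V t * u t * B (x - t) := by ring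
    · simp [hB0 t htb]

/-- Allegretto–Piepenbrink: a nontrivial nonnegative distributional solution of `-Δu ≥ V u`
forces the quadratic form of `-Δ - V` to be nonnegative. -/
theorem integral_potential_mul_sq_le (hΩ : IsOpen Ω) (hΩc : IsPreconnected Ω)
    (hu : LocallyIntegrableOn u Ω volume) (hu0 : ∀ᵐ x ∂volume.restrict Ω, 0 ≤ u x)
    (hV : ContinuousOn V Ω) (hV0 : ∀ x ∈ Ω, 0 ≤ V x)
    (hsup : ∀ φ, IsTestFunction Ω φ → (∀ x, 0 ≤ φ x) →
      ∫ x in Ω, V x * u x * φ x ≤ -∫ x in Ω, u x * Laplacian.laplacian φ x)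
    (hne : ¬ ∀ᵐ x ∂volume.restrict Ω, u x = 0) {φ : EuclideanSpace ℝ (Fin N) → ℝ}
    (hφ : ContDiff ℝ 1 φ) (hc : HasCompactSupport φ) (hs : tsupport φ ⊆ Ω) :
    ∫ x, V x * φ x ^ 2 ≤ ∫ x, ‖∇ φ x‖ ^ 2 := by
  have hsq : tsupport (fun x => φ x ^ 2) ⊆ tsupport φ :=
    closure_mono fun x hx h0 => hx (by simp [h0])
  have hcsq : HasCompactSupport (fun x => φ x ^ 2) := hc.of_isClosed_subset (isClosed_tsupport _) hsq
  have hi : Integrable fun x => φ x ^ 2 :=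
    (hφ.continuous.pow 2).integrable_of_hasCompactSupport hcsq
  have hVi : Integrable fun x => V x * φ x ^ 2 := by
    refine Continuous.integrable_of_hasCompactSupport ?_ hcsq.mul_left
    exact (hV.mul (hφ.continuous.pow 2).continuousOn).continuous_of_tsupport_subset hΩ
      ((tsupport_mul_subset_right.trans hsq).trans hs)
  have key : ∀ η > 0, ∫ x, V x * φ x ^ 2 ≤ (∫ x, ‖∇ φ x‖ ^ 2) + η * ∫ x, φ x ^ 2 := by
    intro η hη
    obtain ⟨w, hw, hwK⟩ := exists_contDiff_supersolution hΩ hΩc hu hu0 hV hV0 hsup hne hc hs hη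
    have e : (fun x => (V x - η) * φ x ^ 2) = fun x => V x * φ x ^ 2 - η * φ x ^ 2 := by
      funext x; ring
    have := integral_mul_sq_le_integral_norm_gradient_sq (Q := fun x => V x - η) hφ hc hw
      (fun x hx => (hwK x hx).1) (fun x hx => (hwK x hx).2)
      (by rw [e]; exact hVi.sub (hi.const_mul η))
    rw [e, integral_sub hVi (hi.const_mul η), integral_const_mul] at this
    linarith
  have h0 : 0 ≤ ∫ x, φ x ^ 2 := integral_nonneg fun x => sq_nonneg _
  refine le_of_forall_pos_le_add fun ε hε => (key (ε / (1 + ∫ x, φ x ^ 2)) (by positivity)).trans ?_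
  gcongr
  rw [div_mul_eq_mul_div, div_le_iff₀ (by positivity)]
  nlinarith

end AllegrettoPiepenbrink

/-! ### Averaging over dilations -/

section Averaging

theorem integrable_mul_comp_sub {Y : Type*} [MeasurableSpace Y] {ν : Measure Y} [SFinite ν]
    {a l : Y → ℝ} {k : ℝ → ℝ} (ha : Integrable a ν) (ham : Measurable a) (hl : Measurable l)
    (hk : Integrable k) (hkm : Measurable k) :
    Integrable (fun p : ℝ × Y => a p.2 * k (p.1 - l p.2)) (volume.prod ν) := by
  have hm : Measurable fun p : ℝ × Y => a p.2 * k (p.1 - l p.2) :=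
    (ham.comp measurable_snd).mul (hkm.comp (measurable_fst.sub (hl.comp measurable_snd)))
  rw [integrable_prod_iff' hm.aestronglyMeasurable]
  refine ⟨Filter.Eventually.of_forall fun y => (hk.comp_sub_right (l y)).const_mul (a y), ?_⟩
  have : (fun y => ∫ t, ‖a y * k (t - l y)‖) = fun y => ‖a y‖ * ∫ t, ‖k t‖ := by
    funext y
    simp_rw [norm_mul]
    rw [integral_const_mul, integral_sub_right_eq_self (fun t => ‖k t‖)]
  simp only [this]
  exact ha.norm.mul_const _

/-- By Fubini the `t`-integral is taken first, and translation invariance makes it independent of `l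
y`. This is the decoupling mechanism. -/
theorem integral_integral_mul_comp_sub {Y : Type*} [MeasurableSpace Y] {ν : Measure Y} [SFinite ν]
    {a l : Y → ℝ} {k : ℝ → ℝ} (ha : Integrable a ν) (ham : Measurable a) (hl : Measurable l)
    (hk : Integrable k) (hkm : Measurable k) :
    ∫ t, ∫ y, a y * k (t - l y) ∂ν = (∫ y, a y ∂ν) * ∫ t, k t := by
  rw [integral_integral_swap (f := fun t y => a y * k (t - l y))
    (integrable_mul_comp_sub ha ham hl hk hkm)]
  simp_rw [integral_const_mul]
  rw [← integral_mul_const]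
  congr 1
  funext y
  rw [integral_sub_right_eq_self k]

theorem integral_mul_deriv_self {f : ℝ → ℝ} (hf : ContDiff ℝ 1 f) (hc : HasCompactSupport f) :
    ∫ s, f s * deriv f s = 0 := by
  have hd : ∀ s, HasDerivAt (fun s => f s ^ 2 / 2) (f s * deriv f s) s := fun s => by
    have := (((hf.differentiable (by norm_num)) s).hasDerivAt.pow 2).div_const 2
    refine this.congr_deriv ?_
    push_cast
    ring
  have hd' := hf.continuous_deriv (by norm_num)
  refine integral_eq_zero_of_hasDerivAt_of_integrable hd ?_ ?_
  · exact (hf.continuous.mul hd').integrable_of_hasCompactSupport hc.mul_right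
  · refine ((hf.continuous.pow 2).div_const 2).integrable_of_hasCompactSupport
      (hc.mono fun s hs h0 => hs (by simp [h0]))

variable {E : Type*} [NormedAddCommGroup E] [InnerProductSpace ℝ E]

theorem contDiffAt_comp_log_norm {f : ℝ → ℝ} (hf : ContDiff ℝ 1 f) (t : ℝ) {y : E} (hy : y ≠ 0) :
    ContDiffAt ℝ 1 (fun y : E => f (t - Real.log ‖y‖)) y :=
  hf.contDiffAt.comp y (contDiffAt_const.sub ((contDiffAt_norm ℝ hy).log (norm_ne_zero_iff.mpr hy)))

theorem contDiff_comp_log_norm_mul {f : ℝ → ℝ} (hf : ContDiff ℝ 1 f) {ψ : E → ℝ}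
    (hψ : ContDiff ℝ 1 ψ) (h0 : (0 : E) ∉ tsupport ψ) (t : ℝ) :
    ContDiff ℝ 1 (fun y : E => f (t - Real.log ‖y‖) * ψ y) := by
  rw [contDiff_iff_contDiffAt]
  intro y
  by_cases hy : y ∈ tsupport ψ
  · exact (contDiffAt_comp_log_norm hf t fun h => h0 (h ▸ hy)).mul hψ.contDiffAt
  · refine contDiffAt_const (c := (0 : ℝ)) |>.congr_of_eventuallyEq ?_
    filter_upwards [notMem_tsupport_iff_eventuallyEq.mp hy] with z hz
    simp [hz]

variable [FiniteDimensional ℝ E]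

/-- Expand the square using `∇ log‖y‖ = y/‖y‖²`. Each term is a function of `y` times a translate of
a function of one variable, the shape required for averaging. -/
theorem norm_gradient_comp_log_norm_mul {f : ℝ → ℝ} (hf : ContDiff ℝ 1 f) {ψ : E → ℝ}
    (hψ : ContDiff ℝ 1 ψ) (h0 : (0 : E) ∉ tsupport ψ) (t : ℝ) (y : E) :
    ‖∇ (fun y : E => f (t - Real.log ‖y‖) * ψ y) y‖ ^ 2 =
      ‖∇ ψ y‖ ^ 2 * f (t - Real.log ‖y‖) ^ 2 -
      2 * ((ψ y * inner ℝ (∇ ψ y) y * (‖y‖ ^ 2)⁻¹) *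
        (f (t - Real.log ‖y‖) * deriv f (t - Real.log ‖y‖))) +
      ((‖y‖ ^ 2)⁻¹ * ψ y ^ 2) * deriv f (t - Real.log ‖y‖) ^ 2 := by
  by_cases hy : y ∈ tsupport ψ
  · have hy0 : y ≠ 0 := fun h => h0 (h ▸ hy)
    have hn : ‖y‖ ≠ 0 := norm_ne_zero_iff.mpr hy0
    have hlog : HasFDerivAt (fun y : E => Real.log ‖y‖) ((‖y‖ ^ 2)⁻¹ • innerSL ℝ y) y := by
      have h1 := (((hasFDerivAt_id y).norm_sq).log (by simpa using hn)).const_mul (1 / 2 : ℝ)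
      have e : (fun y : E => Real.log ‖y‖) = fun y => (1 / 2 : ℝ) * Real.log (‖id y‖ ^ 2) := by
        funext z
        rw [Real.log_pow]
        simp
      rw [e]
      refine h1.congr_fderiv ?_
      ext v
      simp
      ring
    have hfd := ((hf.differentiable (by norm_num)) (t - Real.log ‖y‖)).hasDerivAt.comp_hasFDerivAt y
      (hlog.const_sub t)
    have hd := hfd.mul (hψ.differentiable (by norm_num) y).hasFDerivAt
    have hg : ∇ (fun y : E => f (t - Real.log ‖y‖) * ψ y) y =
        f (t - Real.log ‖y‖) • ∇ ψ y -
          (deriv f (t - Real.log ‖y‖) * ψ y * (‖y‖ ^ 2)⁻¹) • y := by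
      refine ext_inner_right ℝ fun v => ?_
      rw [inner_gradient_left, show (fun y : E => f (t - Real.log ‖y‖) * ψ y) =
        (f ∘ fun y => t - Real.log ‖y‖) * ψ from rfl, hd.fderiv, inner_sub_left,
        real_inner_smul_left, real_inner_smul_left, inner_gradient_left]
      simp
      ring
    rw [hg, norm_sub_sq_real, norm_smul, norm_smul, real_inner_smul_left, real_inner_smul_right,
      mul_pow, mul_pow, Real.norm_eq_abs, Real.norm_eq_abs, sq_abs, sq_abs]
    field_simp
  · have hz : (fun y : E => f (t - Real.log ‖y‖) * ψ y) =ᶠ[nhds y] fun _ => (0 : ℝ) := by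
      filter_upwards [notMem_tsupport_iff_eventuallyEq.mp hy] with z hz
      simp [hz]
    have h1 : ∇ (fun y : E => f (t - Real.log ‖y‖) * ψ y) y = 0 :=
      gradient_eq_zero_of_notMem_tsupport (notMem_tsupport_iff_eventuallyEq.mpr hz)
    rw [h1, gradient_eq_zero_of_notMem_tsupport hy, image_eq_zero_of_notMem_tsupport hy]
    simp

theorem gradient_comp_smul {g : E → ℝ} (hg : Differentiable ℝ g) (r : ℝ) (x : E) :
    ∇ (fun x => g (r • x)) x = r • ∇ g (r • x) := by
  refine ext_inner_right ℝ fun v => ?_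
  have h := (hg (r • x)).hasFDerivAt.comp x ((hasFDerivAt_id x).const_smul r)
  rw [inner_gradient_left, real_inner_smul_left, inner_gradient_left]
  erw [h.fderiv]
  simp

variable [MeasurableSpace E] [BorelSpace E]

/-- Testing a form inequality on the rescaled functions `f(-log |x|) ψ(eᵗ x)` and integrating over
all `t` decouples the radial from the angular variables. -/
theorem integral_gradient_sq_add_of_forall_dilation {f : ℝ → ℝ} (hf : ContDiff ℝ 1 f)
    (hfc : HasCompactSupport f) (hf0 : tsupport f ⊆ Set.Ioi 0) {ψ : E → ℝ} (hψ : ContDiff ℝ 1 ψ)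
    (hψc : HasCompactSupport ψ) (h0 : (0 : E) ∉ tsupport ψ) {c α : ℝ}
    (h : ∀ t : ℝ, ∫ y, (c + α * ((t - Real.log ‖y‖) ^ 2)⁻¹) * (‖y‖ ^ 2)⁻¹ *
        (f (t - Real.log ‖y‖) * ψ y) ^ 2 ≤
      ∫ y, ‖∇ (fun y : E => f (t - Real.log ‖y‖) * ψ y) y‖ ^ 2) :
    c * ((∫ y, (‖y‖ ^ 2)⁻¹ * ψ y ^ 2) * ∫ s, f s ^ 2) +
      α * ((∫ y, (‖y‖ ^ 2)⁻¹ * ψ y ^ 2) * ∫ s, (s ^ 2)⁻¹ * f s ^ 2) ≤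
    (∫ y, ‖∇ ψ y‖ ^ 2) * (∫ s, f s ^ 2) +
      (∫ y, (‖y‖ ^ 2)⁻¹ * ψ y ^ 2) * ∫ s, deriv f s ^ 2 := by
  let l : E → ℝ := fun y => Real.log ‖y‖
  have hl : Measurable l := Real.measurable_log.comp measurable_norm
  let A : E → ℝ := fun y => ‖∇ ψ y‖ ^ 2
  let B : E → ℝ := fun y => ψ y * inner ℝ (∇ ψ y) y * (‖y‖ ^ 2)⁻¹
  let D : E → ℝ := fun y => (‖y‖ ^ 2)⁻¹ * ψ y ^ 2
  let k₁ : ℝ → ℝ := fun s => f s ^ 2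
  let k₂ : ℝ → ℝ := fun s => (s ^ 2)⁻¹ * f s ^ 2
  let k₃ : ℝ → ℝ := fun s => f s * deriv f s
  let k₄ : ℝ → ℝ := fun s => deriv f s ^ 2
  have hfd := hf.continuous_deriv (by norm_num)
  have hk₁ : Continuous k₁ ∧ HasCompactSupport k₁ :=
    ⟨hf.continuous.pow 2, hfc.mono fun s hs h0 => hs (by simp [k₁, h0])⟩
  have hk₃ : Continuous k₃ ∧ HasCompactSupport k₃ := ⟨hf.continuous.mul hfd, hfc.mul_right⟩
  have hk₄ : Continuous k₄ ∧ HasCompactSupport k₄ :=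
    ⟨hfd.pow 2, hfc.deriv.mono fun s hs h0 => hs (by simp [k₄, h0])⟩
  have hk₂ : Continuous k₂ ∧ HasCompactSupport k₂ := by
    refine ⟨ContinuousOn.continuous_of_tsupport_subset (s := Set.Ioi 0) ?_ isOpen_Ioi ?_,
      hk₁.2.mul_left⟩
    · exact ((continuousOn_id.pow 2).inv₀ fun s hs => pow_ne_zero 2 (ne_of_gt hs)).mul
        hk₁.1.continuousOn
    · refine (tsupport_mul_subset_right.trans ?_).trans hf0
      exact closure_mono fun s hs h0 => hs (by simp [h0])
  have hψ2 : tsupport (fun y => ψ y ^ 2) ⊆ tsupport ψ :=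
    closure_mono fun s hs h0 => hs (by simp [h0])
  have hinv : ContinuousOn (fun y : E => (‖y‖ ^ 2)⁻¹) {0}ᶜ :=
    (continuous_norm.pow 2).continuousOn.inv₀ fun y hy => pow_ne_zero 2 (norm_ne_zero_iff.mpr hy)
  have hsub : tsupport ψ ⊆ {0}ᶜ := fun y hy h => h0 (h ▸ hy)
  have hA : Continuous A ∧ HasCompactSupport A := by
    refine ⟨(continuous_gradient hψ).norm.pow 2, hψc.mono' fun y hy => ?_⟩
    by_contra hn
    exact hy (by simp [A, gradient_eq_zero_of_notMem_tsupport hn])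
  have hB : Continuous B ∧ HasCompactSupport B := by
    refine ⟨ContinuousOn.continuous_of_tsupport_subset (s := {0}ᶜ) ?_ isOpen_compl_singleton ?_,
      hψc.mul_right.mul_right⟩
    · exact (hψ.continuous.mul ((continuous_gradient hψ).inner continuous_id)).continuousOn.mul hinv
    · exact (tsupport_mul_subset_left.trans tsupport_mul_subset_left).trans hsub
  have hD : Continuous D ∧ HasCompactSupport D := by
    refine ⟨ContinuousOn.continuous_of_tsupport_subset (s := {0}ᶜ) ?_ isOpen_compl_singleton ?_,
      HasCompactSupport.mul_left (hψc.of_isClosed_subset (isClosed_tsupport _) hψ2)⟩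
    · exact hinv.mul (hψ.continuous.pow 2).continuousOn
    · exact (tsupport_mul_subset_right.trans hψ2).trans hsub
  have prod : ∀ {a : E → ℝ} {k : ℝ → ℝ}, (Continuous a ∧ HasCompactSupport a) →
      (Continuous k ∧ HasCompactSupport k) →
      Integrable (fun p : ℝ × E => a p.2 * k (p.1 - l p.2)) (volume.prod volume) := fun ha hk =>
    integrable_mul_comp_sub (ha.1.integrable_of_hasCompactSupport ha.2) ha.1.measurable hl
      (hk.1.integrable_of_hasCompactSupport hk.2) hk.1.measurable
  have val : ∀ {a : E → ℝ} {k : ℝ → ℝ}, (Continuous a ∧ HasCompactSupport a) →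
      (Continuous k ∧ HasCompactSupport k) →
      ∫ t, ∫ y, a y * k (t - l y) = (∫ y, a y) * ∫ s, k s := fun ha hk =>
    integral_integral_mul_comp_sub (ha.1.integrable_of_hasCompactSupport ha.2) ha.1.measurable hl
      (hk.1.integrable_of_hasCompactSupport hk.2) hk.1.measurable
  have i11 := prod hA hk₁
  have i23 := prod hB hk₃
  have i34 := prod hD hk₄
  have i31 := prod hD hk₁
  have i32 := prod hD hk₂
  have I : ∀ {a : E → ℝ} {k : ℝ → ℝ}, (Continuous a ∧ HasCompactSupport a) →
      (Continuous k ∧ HasCompactSupport k) → Integrable fun t => ∫ y, a y * k (t - l y) :=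
    fun ha hk => (prod ha hk).integral_prod_left
  -- Splitting the integral over `y` needs integrable slices, which Fubini supplies only for almost
  -- every `t`.
  have hae : ∀ᵐ t : ℝ, c * (∫ y, D y * k₁ (t - l y)) + α * (∫ y, D y * k₂ (t - l y)) ≤
      (∫ y, A y * k₁ (t - l y)) - 2 * (∫ y, B y * k₃ (t - l y)) + ∫ y, D y * k₄ (t - l y) := by
    filter_upwards [i11.prod_right_ae, i23.prod_right_ae, i34.prod_right_ae, i31.prod_right_ae,
      i32.prod_right_ae] with t j11 j23 j34 j31 j32
    have := h t
    simp_rw [norm_gradient_comp_log_norm_mul hf hψ h0 t] at this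
    have j : Integrable fun y => A y * k₁ (t - l y) - 2 * (B y * k₃ (t - l y)) :=
      j11.sub (j23.const_mul 2)
    rw [← integral_const_mul, ← integral_const_mul, ← integral_const_mul,
      ← integral_add (j31.const_mul c) (j32.const_mul α), ← integral_sub j11 (j23.const_mul 2),
      ← integral_add j j34]
    refine le_trans (le_of_eq ?_) this
    congr 1
    funext y
    simp only [D, k₁, k₂, l]
    ring
  have J : Integrable fun t => (∫ y, A y * k₁ (t - l y)) - 2 * ∫ y, B y * k₃ (t - l y) :=
    (I hA hk₁).sub ((I hB hk₃).const_mul 2)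
  have hint := integral_mono_ae (((I hD hk₁).const_mul c).add ((I hD hk₂).const_mul α))
    (J.add (I hD hk₄)) hae
  simp only [Pi.add_apply] at hint
  rw [integral_add ((I hD hk₁).const_mul c) ((I hD hk₂).const_mul α), integral_add J (I hD hk₄),
    integral_sub (I hA hk₁) ((I hB hk₃).const_mul 2),
    integral_const_mul, integral_const_mul, integral_const_mul, val hA hk₁, val hB hk₃, val hD hk₄,
    val hD hk₁, val hD hk₂, integral_mul_deriv_self hf hfc] at hint
  simpa using hint

end Averaging

/-! ### Near-optimal functions on a half-line -/

section OneDimensional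

/-- Smooth functions on a half-line with arbitrarily small Rayleigh quotient. -/
theorem exists_integral_deriv_sq_lt (a : ℝ) {ε : ℝ} (hε : 0 < ε) :
    ∃ g : ℝ → ℝ, ContDiff ℝ 1 g ∧ HasCompactSupport g ∧ tsupport g ⊆ Set.Ioi a ∧
      ∫ s, deriv g s ^ 2 < ε * ∫ s, g s ^ 2 := by
  let η : ContDiffBump (0 : ℝ) := ⟨1, 2, one_pos, one_lt_two⟩
  have hη : ContDiff ℝ 1 (η : ℝ → ℝ) := η.contDiff
  set A := ∫ s, deriv η s ^ 2 with hA
  set B := ∫ s, η s ^ 2 with hB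
  have hA0 : 0 ≤ A := integral_nonneg fun s => sq_nonneg _
  have hB0 : 0 < B := by
    refine (hη.continuous.pow 2).integral_pos_of_hasCompactSupport_nonneg_nonzero (x := 0)
      (η.hasCompactSupport.mono fun s hs h0 => hs (by simp [h0])) (fun s => sq_nonneg _) ?_
    have : η 0 = 1 := η.one_of_mem_closedBall (Metric.mem_closedBall_self zero_le_one)
    simp [this]
  -- Stretching by `1/δ` multiplies the Rayleigh quotient by `δ²`; the `+ 1` covers a possibly zero
  -- `A`.
  set δ := Real.sqrt (ε * B / (A + 1)) with hδ
  have hδ0 : 0 < δ := Real.sqrt_pos.mpr (by positivity)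
  have hδ2 : δ ^ 2 * A < ε * B := by
    rw [hδ, Real.sq_sqrt (by positivity), div_mul_eq_mul_div, div_lt_iff₀ (by positivity)]
    nlinarith [mul_pos hε hB0]
  -- The bump has radius 2, so this shift puts the left end of the support at `a + 1/δ`.
  let M := δ * a + 3
  let g : ℝ → ℝ := fun s => η (δ * s - M)
  have hgd : ∀ s, deriv g s = δ * deriv η (δ * s - M) := by
    intro s
    have h1 : HasDerivAt (fun s => δ * s - M) δ s := by
      simpa using ((hasDerivAt_id s).const_mul δ).sub_const M
    have := (hη.differentiable (by norm_num) (δ * s - M)).hasDerivAt.comp s h1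
    rw [show g = η ∘ fun s => δ * s - M from rfl, this.deriv, mul_comm]
  have hint : ∀ F : ℝ → ℝ, ∫ s, F (δ * s - M) = δ⁻¹ * ∫ s, F s := by
    intro F
    rw [Measure.integral_comp_mul_left (fun s => F (s - M)), integral_sub_right_eq_self,
      abs_of_pos (inv_pos.mpr hδ0), smul_eq_mul]
  have hsupp : tsupport g ⊆ Set.Icc ((M - 2) / δ) ((M + 2) / δ) := by
    refine closure_minimal (fun s hs => ?_) isClosed_Icc
    have h1 : δ * s - M ∈ Metric.closedBall (0 : ℝ) 2 := by
      by_contra h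
      refine hs (η.zero_of_le_dist ?_)
      rw [Metric.mem_closedBall] at h
      exact (not_le.mp h).le
    rw [mem_closedBall_zero_iff, Real.norm_eq_abs, abs_le] at h1
    constructor
    · rw [div_le_iff₀ hδ0]; linarith
    · rw [le_div_iff₀ hδ0]; linarith
  refine ⟨g, hη.comp ((contDiff_const.mul contDiff_id).sub contDiff_const),
    isCompact_Icc.of_isClosed_subset (isClosed_tsupport _) hsupp, fun s hs => ?_, ?_⟩
  · have h1 := (hsupp hs).1
    rw [div_le_iff₀ hδ0] at h1
    simp only [M] at h1
    rw [Set.mem_Ioi]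
    nlinarith
  · simp_rw [hgd]
    rw [hint (fun s => (δ * deriv η s) ^ 2), hint (fun s => η s ^ 2)]
    simp_rw [mul_pow]
    rw [integral_const_mul]
    have : δ⁻¹ * (δ ^ 2 * A) < δ⁻¹ * (ε * B) := mul_lt_mul_of_pos_left hδ2 (inv_pos.mpr hδ0)
    linarith

theorem integral_eq_integral_exp_mul {F : ℝ → ℝ} (hF : ∀ s ≤ 0, F s = 0) :
    ∫ s, F s = ∫ τ, Real.exp τ * F (Real.exp τ) := by
  rw [← setIntegral_eq_integral_of_forall_compl_eq_zero (s := Set.Ioi 0)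
    fun s hs => hF s (not_lt.mp hs)]
  have h := integral_image_eq_integral_abs_deriv_smul (s := Set.univ) MeasurableSet.univ
    (fun τ _ => (Real.hasDerivAt_exp τ).hasDerivWithinAt) Real.exp_injective.injOn F
  rw [Set.image_univ, Real.range_exp] at h
  simpa [abs_of_pos (Real.exp_pos _)] using h

/-- The constant `1/4` in the Hardy inequality on a half-line `(a, ∞)` cannot be improved. -/
theorem exists_integral_deriv_sq_lt_hardy {a α : ℝ} (ha : 0 ≤ a) (hα : 1 / 4 < α) :
    ∃ f : ℝ → ℝ, ContDiff ℝ 1 f ∧ HasCompactSupport f ∧ tsupport f ⊆ Set.Ioi a ∧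
      ∫ s, deriv f s ^ 2 < α * ∫ s, (s ^ 2)⁻¹ * f s ^ 2 := by
  obtain ⟨g, hg, hgc, hgs, hlt⟩ := exists_integral_deriv_sq_lt (Real.log (a + 1)) (sub_pos.mpr hα)
  -- `√s` is the virtual ground state of the half-line Hardy inequality. With `s = e^τ`, the
  -- quotient of `f` becomes `1/4` plus the Rayleigh quotient of `g`, and the latter is below `α -
  -- 1/4`.
  let f : ℝ → ℝ := fun s => Real.sqrt s * g (Real.log s)
  have hsub : tsupport f ⊆ Real.exp '' tsupport g := by
    refine closure_minimal (fun s hs => ?_) (hgc.isCompact.image Real.continuous_exp).isClosed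
    have hs0 : 0 < s := Real.sqrt_ne_zero'.mp (left_ne_zero_of_mul hs)
    exact ⟨Real.log s, subset_tsupport _ (right_ne_zero_of_mul hs), Real.exp_log hs0⟩
  have hpos : tsupport f ⊆ Set.Ioi 0 := fun s hs => by
    obtain ⟨τ, -, rfl⟩ := hsub hs
    exact Real.exp_pos τ
  have hgd := hg.differentiable (by norm_num)
  have hfd : ∀ τ, deriv f (Real.exp τ) = (Real.sqrt (Real.exp τ))⁻¹ * (g τ / 2 + deriv g τ) := by
    intro τ
    have hp := Real.exp_pos τ
    have h1 := (Real.hasDerivAt_sqrt hp.ne').mul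
      ((hgd (Real.log (Real.exp τ))).hasDerivAt.comp _ (Real.hasDerivAt_log hp.ne'))
    rw [show f = Real.sqrt * (g ∘ Real.log) from rfl, h1.deriv]
    simp only [Function.comp_apply, Real.log_exp]
    have h2 : Real.sqrt (Real.exp τ) ≠ 0 := (Real.sqrt_pos.mpr hp).ne'
    have h3 : (Real.exp τ)⁻¹ = (Real.sqrt (Real.exp τ))⁻¹ * (Real.sqrt (Real.exp τ))⁻¹ := by
      rw [← mul_inv, Real.mul_self_sqrt hp.le]
    rw [h3]
    field_simp
  refine ⟨f, ?_, (hgc.isCompact.image Real.continuous_exp).of_isClosed_subset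
    (isClosed_tsupport _) hsub, ?_, ?_⟩
  · rw [contDiff_iff_contDiffAt]
    intro s
    by_cases hs : s ∈ tsupport f
    · have h0 : s ≠ 0 := ne_of_gt (hpos hs)
      exact (Real.contDiffAt_sqrt h0).mul (hg.contDiffAt.comp s (Real.contDiffAt_log.mpr h0))
    · exact contDiffAt_const.congr_of_eventuallyEq (notMem_tsupport_iff_eventuallyEq.mp hs)
  · intro s hs
    obtain ⟨τ, hτ, rfl⟩ := hsub hs
    have := (Real.log_lt_iff_lt_exp (by linarith)).mp (hgs hτ)
    rw [Set.mem_Ioi]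
    linarith
  · have hg' := hg.continuous_deriv (by norm_num)
    have i1 : Integrable fun τ => g τ ^ 2 :=
      (hg.continuous.pow 2).integrable_of_hasCompactSupport
        (hgc.mono fun s hs h0 => hs (by simp [h0]))
    have i2 : Integrable fun τ => deriv g τ ^ 2 :=
      (hg'.pow 2).integrable_of_hasCompactSupport
        (hgc.deriv.mono fun s hs h0 => hs (by simp [h0]))
    have i3 : Integrable fun τ => g τ * deriv g τ :=
      (hg.continuous.mul hg').integrable_of_hasCompactSupport hgc.mul_right
    have e1 : ∫ s, deriv f s ^ 2 = 1 / 4 * (∫ τ, g τ ^ 2) + ∫ τ, deriv g τ ^ 2 := by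
      rw [integral_eq_integral_exp_mul]
      · have : (fun τ => Real.exp τ * deriv f (Real.exp τ) ^ 2) =
            fun τ => 1 / 4 * g τ ^ 2 + g τ * deriv g τ + deriv g τ ^ 2 := by
          funext τ
          have hp := Real.exp_pos τ
          rw [hfd, mul_pow, inv_pow, Real.sq_sqrt hp.le]
          field_simp
          ring
        have j : Integrable fun τ => 1 / 4 * g τ ^ 2 + g τ * deriv g τ := (i1.const_mul _).add i3
        rw [this, integral_add j i2, integral_add (i1.const_mul _) i3, integral_const_mul,
          integral_mul_deriv_self hg hgc, add_zero]
      · intro s hs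
        have : s ∉ tsupport f := fun h => not_lt.mpr hs (hpos h)
        have : deriv f s = 0 := by
          by_contra h
          exact this (support_deriv_subset h)
        simp [this]
    have e2 : ∫ s, (s ^ 2)⁻¹ * f s ^ 2 = ∫ τ, g τ ^ 2 := by
      rw [integral_eq_integral_exp_mul fun s hs => by simp [f, Real.sqrt_eq_zero_of_nonpos hs]]
      congr 1
      funext τ
      have hp := Real.exp_pos τ
      simp only [f, mul_pow, Real.sq_sqrt hp.le, Real.log_exp]
      field_simp
    rw [e1, e2]
    linarith

end OneDimensional

/-! ### Geometry of the cone and near-minimizers of the Hardy quotient -/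

section Cone

variable {N : ℕ} {Sig : Set (Metric.sphere (0 : EuclideanSpace ℝ (Fin N)) 1)} {R : ℝ}

theorem ne_zero_of_mem_cone {x : EuclideanSpace ℝ (Fin N)} (hx : x ∈ cone Sig) : x ≠ 0 := by
  obtain ⟨r, hr, σ, -, rfl⟩ := hx
  refine smul_ne_zero hr.ne' fun h => ?_
  have := mem_sphere_zero_iff_norm.mp σ.2
  simp [h] at this

theorem smul_mem_cone {x : EuclideanSpace ℝ (Fin N)} (hx : x ∈ cone Sig) {r : ℝ} (hr : 0 < r) :
    r • x ∈ cone Sig := by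
  obtain ⟨s, hs, σ, hσ, rfl⟩ := hx
  exact ⟨r * s, mul_pos hr hs, σ, hσ, by rw [smul_smul]⟩

theorem isOpen_cone (hSig : IsOpen Sig) : IsOpen (cone Sig) := by
  obtain ⟨U, hU, rfl⟩ := isOpen_induced_iff.mp hSig
  have hc : ContinuousOn (fun x : EuclideanSpace ℝ (Fin N) => ‖x‖⁻¹ • x) {0}ᶜ :=
    (continuous_norm.continuousOn.inv₀ fun x hx => norm_ne_zero_iff.mpr hx).smul continuousOn_id
  have h := hc.isOpen_inter_preimage isOpen_compl_singleton hU
  convert h using 1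
  ext x
  constructor
  · intro hx
    refine ⟨ne_zero_of_mem_cone hx, ?_⟩
    obtain ⟨r, hr, σ, hσ, rfl⟩ := hx
    have h1 : ‖(σ : EuclideanSpace ℝ (Fin N))‖ = 1 := mem_sphere_zero_iff_norm.mp σ.2
    simp only [Set.mem_preimage, norm_smul, h1, Real.norm_eq_abs, abs_of_pos hr, mul_one,
      smul_smul, inv_mul_cancel₀ hr.ne', one_smul]
    exact hσ
  · rintro ⟨hx0, hx⟩
    have hn : 0 < ‖x‖ := norm_pos_iff.mpr hx0
    refine ⟨‖x‖, hn, ⟨‖x‖⁻¹ • x, ?_⟩, hx, ?_⟩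
    · simp [norm_smul, hn.ne']
    · rw [smul_smul, mul_inv_cancel₀ hn.ne', one_smul]

theorem isOpen_coneBall (hSig : IsOpen Sig) : IsOpen (coneBall Sig R) :=
  (isOpen_cone hSig).inter Metric.isOpen_ball

theorem coneBall_eq_image : coneBall Sig R =
    (fun p : ℝ × Metric.sphere (0 : EuclideanSpace ℝ (Fin N)) 1 =>
      p.1 • (p.2 : EuclideanSpace ℝ (Fin N))) '' (Set.Ioo 0 R ×ˢ Sig) := by
  have hn : ∀ r : ℝ, 0 < r → ∀ σ : Metric.sphere (0 : EuclideanSpace ℝ (Fin N)) 1,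
      ‖r • (σ : EuclideanSpace ℝ (Fin N))‖ = r := fun r hr σ => by
    rw [norm_smul, mem_sphere_zero_iff_norm.mp σ.2, mul_one, Real.norm_eq_abs, abs_of_pos hr]
  ext x
  constructor
  · rintro ⟨⟨r, hr, σ, hσ, rfl⟩, hx⟩
    rw [mem_ball_zero_iff, hn r hr] at hx
    exact ⟨(r, σ), ⟨⟨hr, hx⟩, hσ⟩, rfl⟩
  · rintro ⟨⟨r, σ⟩, ⟨⟨hr, hr'⟩, hσ⟩, rfl⟩
    exact ⟨⟨r, hr, σ, hσ, rfl⟩, by rwa [mem_ball_zero_iff, hn r hr]⟩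

theorem isPreconnected_coneBall (hSig : IsPreconnected Sig) : IsPreconnected (coneBall Sig R) := by
  rw [coneBall_eq_image]
  exact (isPreconnected_Ioo.prod hSig).image _ (by fun_prop)

theorem cone_nonempty (hSig : Sig.Nonempty) : (cone Sig).Nonempty := by
  obtain ⟨σ, hσ⟩ := hSig
  exact ⟨σ, 1, one_pos, σ, hσ, (one_smul _ _).symm⟩

/-- A form inequality on `C¹` functions supported in the truncated cone, rescaled. -/
theorem form_inequality_of_dilation {c α : ℝ} (hR : 0 < R)
    (hform : ∀ φ : EuclideanSpace ℝ (Fin N) → ℝ, ContDiff ℝ 1 φ → HasCompactSupport φ →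
      tsupport φ ⊆ coneBall Sig R →
      ∫ x, (c * ‖x‖ ^ (-2 : ℤ) + α * (‖x‖ ^ (-2 : ℤ) * |Real.log ‖x‖| ^ (-2 : ℤ))) * φ x ^ 2 ≤
        ∫ x, ‖∇ φ x‖ ^ 2)
    {f : ℝ → ℝ} (hf : ContDiff ℝ 1 f) (hfs : tsupport f ⊆ Set.Ioi (-Real.log R))
    {ψ : EuclideanSpace ℝ (Fin N) → ℝ} (hψ : IsTestFunction (cone Sig) ψ) (t : ℝ) :
    ∫ y, (c + α * ((t - Real.log ‖y‖) ^ 2)⁻¹) * (‖y‖ ^ 2)⁻¹ * (f (t - Real.log ‖y‖) * ψ y) ^ 2 ≤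
      ∫ y, ‖∇ (fun y => f (t - Real.log ‖y‖) * ψ y) y‖ ^ 2 := by
  have h0 : (0 : EuclideanSpace ℝ (Fin N)) ∉ tsupport ψ := fun h =>
    ne_zero_of_mem_cone (hψ.tsupport_subset h) rfl
  let Φ : EuclideanSpace ℝ (Fin N) → ℝ := fun y => f (t - Real.log ‖y‖) * ψ y
  have hΦ : ContDiff ℝ 1 Φ :=
    contDiff_comp_log_norm_mul hf (hψ.contDiff.of_le ENat.LEInfty.out) h0 t
  have hΦc : HasCompactSupport Φ := hψ.hasCompactSupport.mul_left
  have hr : 0 < Real.exp t := Real.exp_pos t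
  -- A closed set containing the support of `Φ`: the first factor places the dilated function in the
  -- cone, the second inside the ball.
  let T : Set (EuclideanSpace ℝ (Fin N)) :=
    tsupport ψ ∩ (fun y => t - Real.log ‖y‖) ⁻¹' tsupport f
  have hT : IsClosed T := by
    refine ContinuousOn.preimage_isClosed_of_isClosed ?_ (isClosed_tsupport _) (isClosed_tsupport _)
    exact continuousOn_const.sub (continuous_norm.continuousOn.log fun y hy =>
      norm_ne_zero_iff.mpr fun h => h0 (h ▸ hy))
  have hlog : ∀ x : EuclideanSpace ℝ (Fin N), x ≠ 0 →
      t - Real.log ‖Real.exp t • x‖ = -Real.log ‖x‖ := by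
    intro x hx
    rw [norm_smul, Real.norm_eq_abs, abs_of_pos hr,
      Real.log_mul hr.ne' (norm_ne_zero_iff.mpr hx), Real.log_exp]
    ring
  have hsub : tsupport (fun x => Φ (Real.exp t • x)) ⊆ coneBall Sig R := by
    have h1 : tsupport (fun x => Φ (Real.exp t • x)) ⊆ (fun x => Real.exp t • x) ⁻¹' T := by
      refine closure_minimal (fun x hx => ?_) (hT.preimage (continuous_const_smul _))
      exact ⟨subset_tsupport _ (right_ne_zero_of_mul hx),
        subset_tsupport _ (left_ne_zero_of_mul hx)⟩
    intro x hx
    obtain ⟨hx1, hx2⟩ := h1 hx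
    have hxc : x ∈ cone Sig := by
      have := smul_mem_cone (hψ.tsupport_subset hx1) (inv_pos.mpr hr)
      rwa [smul_smul, inv_mul_cancel₀ hr.ne', one_smul] at this
    have hx0 := ne_zero_of_mem_cone hxc
    refine ⟨hxc, ?_⟩
    have h2 := hfs hx2
    simp only [hlog x hx0, Set.mem_Ioi, neg_lt_neg_iff] at h2
    rw [mem_ball_zero_iff]
    exact (Real.log_lt_log_iff (norm_pos_iff.mpr hx0) hR).mp h2
  have key := hform (fun x => Φ (Real.exp t • x)) (hΦ.comp (contDiff_const_smul _))
    (hΦc.comp_smul hr.ne') hsub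
  simp_rw [gradient_comp_smul (hΦ.differentiable (by norm_num)), norm_smul, mul_pow] at key
  let W : EuclideanSpace ℝ (Fin N) → ℝ := fun y =>
    (c + α * ((t - Real.log ‖y‖) ^ 2)⁻¹) * (‖y‖ ^ 2)⁻¹ * Φ y ^ 2
  -- The potential scales like `‖x‖⁻²`, so both sides acquire the same factor `e^{2t}`, and the same
  -- Jacobian after the change of variables.
  have hW : (fun x : EuclideanSpace ℝ (Fin N) =>
      (c * ‖x‖ ^ (-2 : ℤ) + α * (‖x‖ ^ (-2 : ℤ) * |Real.log ‖x‖| ^ (-2 : ℤ))) *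
        Φ (Real.exp t • x) ^ 2) = fun x => ‖Real.exp t‖ ^ 2 * W (Real.exp t • x) := by
    funext x
    by_cases hx : x = 0
    · simp [hx, W, Φ, image_eq_zero_of_notMem_tsupport h0]
    · have hn : ‖x‖ ≠ 0 := norm_ne_zero_iff.mpr hx
      simp only [W, hlog x hx]
      rw [norm_smul, neg_sq, zpow_neg, zpow_neg]
      norm_cast
      rw [sq_abs]
      have : ‖Real.exp t‖ ≠ 0 := norm_ne_zero_iff.mpr hr.ne'
      field_simp
  rw [hW, integral_const_mul, integral_const_mul, Measure.integral_comp_smul volume W,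
    Measure.integral_comp_smul volume (fun y => ‖∇ Φ y‖ ^ 2)] at key
  have h1 : 0 < ‖Real.exp t‖ ^ 2 := pow_pos (norm_pos_iff.mpr hr.ne') 2
  have h2 : 0 < |(Real.exp t ^ Module.finrank ℝ (EuclideanSpace ℝ (Fin N)))⁻¹| :=
    abs_pos.mpr (inv_ne_zero (pow_ne_zero _ hr.ne'))
  simp only [smul_eq_mul] at key
  exact le_of_mul_le_mul_left (le_of_mul_le_mul_left key h1) h2

theorem IsTestFunction.integral_inv_sq_mul_sq_pos {ψ : EuclideanSpace ℝ (Fin N) → ℝ}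
    (hψ : IsTestFunction (cone Sig) ψ) (hne : ψ ≠ 0) : 0 < ∫ y, (‖y‖ ^ 2)⁻¹ * ψ y ^ 2 := by
  obtain ⟨y, hy⟩ := Function.ne_iff.mp hne
  have hy' : ψ y ≠ 0 := hy
  have hn : ‖y‖ ≠ 0 := norm_ne_zero_iff.mpr
    (ne_zero_of_mem_cone (hψ.tsupport_subset (subset_tsupport _ hy)))
  have hψ2 : tsupport (fun y => ψ y ^ 2) ⊆ tsupport ψ :=
    closure_mono fun s hs h0 => hs (by simp [h0])
  refine Continuous.integral_pos_of_hasCompactSupport_nonneg_nonzero (x := y) ?_ ?_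
    (fun y => by positivity) (by positivity)
  · refine ContinuousOn.continuous_of_tsupport_subset (s := {0}ᶜ) ?_ isOpen_compl_singleton ?_
    · exact ((continuous_norm.pow 2).continuousOn.inv₀ fun y hy =>
        pow_ne_zero 2 (norm_ne_zero_iff.mpr hy)).mul (hψ.contDiff.continuous.pow 2).continuousOn
    · exact (tsupport_mul_subset_right.trans hψ2).trans fun y hy =>
        ne_zero_of_mem_cone (hψ.tsupport_subset hy)
  · exact HasCompactSupport.mul_left
      (hψ.hasCompactSupport.of_isClosed_subset (isClosed_tsupport _) hψ2)

theorem exists_isTestFunction_ne_zero {Ω : Set (EuclideanSpace ℝ (Fin N))} (hΩ : IsOpen Ω)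
    (hne : Ω.Nonempty) : ∃ ψ, IsTestFunction Ω ψ ∧ ψ ≠ 0 := by
  obtain ⟨x, hx⟩ := hne
  obtain ⟨f, hf, hfc, hfd, -, hf1⟩ := exists_contDiff_tsupport_subset (n := ⊤) (hΩ.mem_nhds hx)
  refine ⟨f, ⟨hfd, hfc, hf⟩, fun h => ?_⟩
  simp [h] at hf1

/-- Test functions on the cone with Rayleigh quotient close to the Hardy constant. -/
theorem exists_integral_gradient_sq_lt (hSig : IsOpen Sig) (hne : Sig.Nonempty) {q : ℝ}
    (hq : hardyConstant Sig < q) : ∃ ψ, IsTestFunction (cone Sig) ψ ∧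
      0 < (∫ y, (‖y‖ ^ 2)⁻¹ * ψ y ^ 2) ∧
      ∫ y, ‖∇ ψ y‖ ^ 2 < q * ∫ y, (‖y‖ ^ 2)⁻¹ * ψ y ^ 2 := by
  obtain ⟨ψ₀, hψ₀, hψ₀ne⟩ := exists_isTestFunction_ne_zero (isOpen_cone hSig) (cone_nonempty hne)
  rw [hardyConstant] at hq
  obtain ⟨_, ⟨ψ, hψ, hψne, rfl⟩, hlt⟩ :=
    exists_lt_of_csInf_lt (by exact ⟨_, ψ₀, hψ₀, hψ₀ne, rfl⟩) hq
  have hpos := hψ.integral_inv_sq_mul_sq_pos hψne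
  refine ⟨ψ, hψ, hpos, ?_⟩
  have e1 : ∫ x in cone Sig, ‖∇ ψ x‖ ^ 2 = ∫ x, ‖∇ ψ x‖ ^ 2 :=
    setIntegral_eq_integral_of_forall_compl_eq_zero fun x hx => by
      rw [gradient_eq_zero_of_notMem_tsupport fun h => hx (hψ.tsupport_subset h)]
      simp
  have e2 : ∫ x in cone Sig, ‖x‖ ^ (-2 : ℤ) * |ψ x| ^ 2 = ∫ x, (‖x‖ ^ 2)⁻¹ * ψ x ^ 2 := by
    rw [setIntegral_eq_integral_of_forall_compl_eq_zero fun x hx => by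
      rw [image_eq_zero_of_notMem_tsupport fun h => hx (hψ.tsupport_subset h)]
      simp]
    congr 1
    funext x
    rw [sq_abs, zpow_neg]
    norm_cast
  rwa [e1, e2, div_lt_iff₀ hpos] at hlt

end Cone

end HardyCone

/-! ### The two nonexistence statements -/

theorem mainTheorem9 (N : ℕ) (hN : 1 ≤ N)
    (Sig : Set (Metric.sphere (0 : EuclideanSpace ℝ (Fin N)) 1))
    (hSig_open : IsOpen Sig) (hSig_conn : IsConnected Sig) (hSig_proper : Sig ≠ Set.univ)
    (R c α : ℝ) (hR0 : 0 < R) (hR1 : R ≤ 1) (hc : 0 ≤ c) (hα : 0 ≤ α)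
    (u : EuclideanSpace ℝ (Fin N) → ℝ)
    (hu_loc : LocallyIntegrableOn u (HardyCone.coneBall Sig R) volume)
    (hu_nonneg : ∀ᵐ x ∂(volume.restrict (HardyCone.coneBall Sig R)), 0 ≤ u x)
    (hu : HardyCone.IsDistribSupersolution (HardyCone.coneBall Sig R) c α u) :
    (HardyCone.hardyConstant Sig < c →
      ∀ᵐ x ∂(volume.restrict (HardyCone.coneBall Sig R)), u x = 0) ∧
    (c = HardyCone.hardyConstant Sig → 1 / 4 < α →
      ∀ᵐ x ∂(volume.restrict (HardyCone.coneBall Sig R)), u x = 0) := by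
  open HardyCone in
  have hΩ := isOpen_coneBall (R := R) hSig_open
  have hlogne : ∀ x ∈ coneBall Sig R, ‖x‖ ≠ 0 ∧ |Real.log ‖x‖| ≠ 0 := by
    rintro x ⟨hx, hxR⟩
    have hn : 0 < ‖x‖ := norm_pos_iff.mpr (ne_zero_of_mem_cone hx)
    rw [mem_ball_zero_iff] at hxR
    -- `R ≤ 1` keeps `log‖x‖` strictly negative, so the logarithmic weight is continuous on the
    -- truncated cone.
    exact ⟨hn.ne', abs_ne_zero.mpr (Real.log_neg hn (hxR.trans_le hR1)).ne⟩
  have hV₁ : ContinuousOn (fun x : EuclideanSpace ℝ (Fin N) => ‖x‖ ^ (-2 : ℤ)) (coneBall Sig R) :=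
    continuous_norm.continuousOn.zpow₀ _ fun x hx => Or.inl (hlogne x hx).1
  have hV₂ : ContinuousOn (fun x : EuclideanSpace ℝ (Fin N) =>
      ‖x‖ ^ (-2 : ℤ) * |Real.log ‖x‖| ^ (-2 : ℤ)) (coneBall Sig R) :=
    hV₁.mul ((continuous_norm.continuousOn.log fun x hx => (hlogne x hx).1).abs.zpow₀ _
      fun x hx => Or.inl (hlogne x hx).2)
  let V : EuclideanSpace ℝ (Fin N) → ℝ := fun x =>
    c * ‖x‖ ^ (-2 : ℤ) + α * (‖x‖ ^ (-2 : ℤ) * |Real.log ‖x‖| ^ (-2 : ℤ))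
  have hV : ContinuousOn V (coneBall Sig R) :=
    (continuousOn_const.mul hV₁).add (continuousOn_const.mul hV₂)
  have hV0 : ∀ x, 0 ≤ V x := fun x => by positivity
  have havg : ¬ (∀ᵐ x ∂(volume.restrict (coneBall Sig R)), u x = 0) →
      ∀ {f : ℝ → ℝ}, ContDiff ℝ 1 f → HasCompactSupport f → tsupport f ⊆ Set.Ioi (-Real.log R) →
      ∀ {ψ : EuclideanSpace ℝ (Fin N) → ℝ}, IsTestFunction (cone Sig) ψ →
      c * ((∫ y, (‖y‖ ^ 2)⁻¹ * ψ y ^ 2) * ∫ s, f s ^ 2) +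
        α * ((∫ y, (‖y‖ ^ 2)⁻¹ * ψ y ^ 2) * ∫ s, (s ^ 2)⁻¹ * f s ^ 2) ≤
      (∫ y, ‖∇ ψ y‖ ^ 2) * (∫ s, f s ^ 2) +
        (∫ y, (‖y‖ ^ 2)⁻¹ * ψ y ^ 2) * ∫ s, deriv f s ^ 2 := by
    intro hne f hf hfc hfs ψ hψ
    refine integral_gradient_sq_add_of_forall_dilation hf hfc (hfs.trans (Set.Ioi_subset_Ioi
      (by linarith [Real.log_nonpos hR0.le hR1]))) (hψ.contDiff.of_le ENat.LEInfty.out)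
      hψ.hasCompactSupport (fun h => ne_zero_of_mem_cone (hψ.tsupport_subset h) rfl)
      (form_inequality_of_dilation hR0 (fun φ hφ hφc hφs => ?_) hf hfs hψ)
    refine integral_potential_mul_sq_le hΩ (isPreconnected_coneBall hSig_conn.isPreconnected)
      hu_loc hu_nonneg hV (fun x _ => hV0 x) (fun χ hχ hχ0 => ?_) hne hφ hφc hφs
    have h1 := hu χ hχ hχ0
    have i1 := integrableOn_mul_mul_of_tsupport_subset hΩ hu_loc hV₁ hχ.contDiff.continuous
      hχ.hasCompactSupport hχ.tsupport_subset
    have i2 := integrableOn_mul_mul_of_tsupport_subset hΩ hu_loc hV₂ hχ.contDiff.continuous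
      hχ.hasCompactSupport hχ.tsupport_subset
    have e : (fun x => V x * u x * χ x) = fun x => c * (‖x‖ ^ (-2 : ℤ) * u x * χ x) +
          α * (‖x‖ ^ (-2 : ℤ) * |Real.log ‖x‖| ^ (-2 : ℤ) * u x * χ x) := by
      funext x; simp only [V]; ring
    rw [e, integral_add (i1.const_mul c) (i2.const_mul α), integral_const_mul, integral_const_mul]
    linarith
  have ha : 0 ≤ -Real.log R := by linarith [Real.log_nonpos hR0.le hR1]
  constructor
  · intro hlt
    by_contra hne
    obtain ⟨ψ, hψ, hD, hQ⟩ := exists_integral_gradient_sq_lt hSig_open hSig_conn.nonempty hlt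
    set D := ∫ y, (‖y‖ ^ 2)⁻¹ * ψ y ^ 2
    set Q := ∫ y, ‖∇ ψ y‖ ^ 2
    -- The gap `(c D - Q)/D` left by `ψ` bounds the radial quotient; the `α` term is nonnegative and
    -- can be dropped.
    obtain ⟨f, hf, hfc, hfs, hF⟩ := exists_integral_deriv_sq_lt (-Real.log R)
      (div_pos (sub_pos.mpr hQ) hD)
    have h := havg hne hf hfc hfs hψ
    have hH : 0 ≤ α * (D * ∫ s, (s ^ 2)⁻¹ * f s ^ 2) :=
      mul_nonneg hα (mul_nonneg hD.le (integral_nonneg fun s => by positivity))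
    rw [div_mul_eq_mul_div, lt_div_iff₀ hD] at hF
    nlinarith
  · intro hceq hα4
    by_contra hne
    obtain ⟨f, hf, hfc, hfs, hF⟩ := exists_integral_deriv_sq_lt_hardy ha hα4
    have hF0 : 0 ≤ ∫ s, f s ^ 2 := integral_nonneg fun s => sq_nonneg _
    refine absurd hF (not_lt.mpr (le_of_forall_pos_le_add fun ε hε => ?_))
    have hε' : 0 < ε / (1 + ∫ s, f s ^ 2) := by positivity
    -- Here `f` is fixed first. The excess of the quotient of `ψ` over `c` is chosen to cost at most
    -- `ε` after multiplication by `∫ f²`.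
    obtain ⟨ψ, hψ, hD, hQ⟩ := exists_integral_gradient_sq_lt hSig_open hSig_conn.nonempty
      (q := c + ε / (1 + ∫ s, f s ^ 2)) (by linarith)
    have h := havg hne hf hfc hfs hψ
    set D := ∫ y, (‖y‖ ^ 2)⁻¹ * ψ y ^ 2
    set Q := ∫ y, ‖∇ ψ y‖ ^ 2
    have h1 : Q * ∫ s, f s ^ 2 ≤ (c + ε / (1 + ∫ s, f s ^ 2)) * D * ∫ s, f s ^ 2 :=
      mul_le_mul_of_nonneg_right hQ.le hF0
    have h2 : ε / (1 + ∫ s, f s ^ 2) * ∫ s, f s ^ 2 ≤ ε := by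
      rw [div_mul_eq_mul_div, div_le_iff₀ (by positivity)]
      nlinarith
    have h3 := mul_le_mul_of_nonneg_left h2 hD.le
    refine le_of_mul_le_mul_left (a := D) ?_ hD
    linarith
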